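/- **Theorem 2.1.** Let $d\ge 1$ and let $\mathcal M$ be a compact $C^\infty$ manifold of dimension $d$ without boundary, smoothly embedded in $\mathbb R^D$ and endowed with the induced Riemannian metric (so that the embedding is isometric); write $dV$ for its Riemannian volume measure and identify $x\in\mathcal M$ with its image in $\mathbb R^D$. Let $p\in C^\infty(\mathcal M)$ satisfy $\int_{\mathcal M}p\,dV=1$ and $0<p_{\min}\le p(x)\le p_{\max}<\infty$ for all $x\in\mathcal M$. Let $y_1,\dots,y_N$ be i.i.d. samples from the distribution $p\,dV$, and for an integer $k=k_N$ put $$\hat R(x)=\inf\Big\{r>0:\ \sum_{j=1}^N \mathbf 1_{\{\|y_j-x\|<r\}}\ge k\Big\},\qquad \hat\rho(x)=\hat R(x)\Big(\frac1{m_0}\frac kN\Big)^{-1/d},\qquad \bar\rho(x)=p(x)^{-1/d},$$ where $m_0=\int_{\mathbb R^d}\mathbf 1_{[0,1)}(|u|^2)\,du$ is the volume of the unit ball of $\mathbb R^d$. Then there is a constant $C>0$, depending only on $(\mathcal M,p)$, such that for every sequence of natural numbers $k=k_N$ with $k/N\to0$ and $k/\log N\to\infty$ as $N\to\infty$, the following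 holds: for all sufficiently large $N$, with probability greater than $1-N^{-10}$, $$\sup_{x\in\mathcal M}\frac{|\hat\rho(x)-\bar\rho(x)|}{\bar\rho(x)}\ \le\ C\Big(\frac kN\Big)^{2/d}+\frac{3\sqrt{13}}{d}\sqrt{\frac{\log N}{k}},$$ and the right-hand side tends to $0$ as $N\to\infty$. -/

import Mathlib

open MeasureTheory Filter Topology Asymptotics
open scoped Manifold ContDiff ENNReal

noncomputable section

/-- The Riemannian volume element written in the chart `φ` of `M` at `x`, for the metric that `M`
inherits from the Euclidean space through `ι`. With `ψ = ι ∘ φ⁻¹` the metric coefficients are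
`g i j = ⟪∂ᵢψ, ∂ⱼψ⟫`, and this is the measure `√(det g) du` on the target of `φ`, carried
to the source of `φ`. -/
def chartVolume {d D : ℕ} {M : Type*} [TopologicalSpace M]
    [ChartedSpace (EuclideanSpace ℝ (Fin d)) M] [MeasurableSpace M]
    (ι : M → EuclideanSpace ℝ (Fin D)) (x : M) : Measure M :=
  Measure.map (chartAt (EuclideanSpace ℝ (Fin d)) x).symm
    (((volume : Measure (EuclideanSpace ℝ (Fin d))).restrict
        (chartAt (EuclideanSpace ℝ (Fin d)) x).target).withDensity
      (fun u => ENNReal.ofReal (Real.sqrt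
        (Matrix.gram ℝ (fun i : Fin d =>
          fderiv ℝ (ι ∘ (chartAt (EuclideanSpace ℝ (Fin d)) x).symm) u
            (EuclideanSpace.basisFun (Fin d) ℝ i))).det)))

/-- The Riemannian volume measure `dV` of `M`, for the metric that `M` inherits from the Euclidean
space through the embedding `ι` (no orientation is used). The measures `chartVolume ι x` agree on
the overlaps of the chart domains, so `dV`, the measure that equals `chartVolume ι x` on the domain
of the chart at `x` for every `x`, is the least measure dominating all of them. -/
def riemannianVolume {d D : ℕ} {M : Type*} [TopologicalSpace M]
    [ChartedSpace (EuclideanSpace ℝ (Fin d)) M] [MeasurableSpace M]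
    (ι : M → EuclideanSpace ℝ (Fin D)) : Measure M :=
  ⨆ x : M, chartVolume (d := d) ι x

/-- The law `p dV` of one sample. -/
def samplingLaw {d D : ℕ} {M : Type*} [TopologicalSpace M]
    [ChartedSpace (EuclideanSpace ℝ (Fin d)) M] [MeasurableSpace M]
    (ι : M → EuclideanSpace ℝ (Fin D)) (p : M → ℝ) : Measure M :=
  (riemannianVolume (d := d) ι).withDensity (fun x => ENNReal.ofReal (p x))

/-- `m₀[h] = ∫_{ℝᵈ} h(|u|²) du`. -/
def m0 (d : ℕ) (h : ℝ → ℝ) : ℝ :=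
  ∫ u : EuclideanSpace ℝ (Fin d), h (‖u‖ ^ 2)

/-- The distance `R̂(z)` from `z` to its `k`-th nearest neighbour among the points `y j`:
the infimum of all `r > 0` such that at least `k` of the points satisfy `‖y j - z‖ < r`. -/
def knnRadius {D N : ℕ} (k : ℕ) (y : Fin N → EuclideanSpace ℝ (Fin D))
    (z : EuclideanSpace ℝ (Fin D)) : ℝ :=
  sInf {r : ℝ | 0 < r ∧ k ≤ (Finset.univ.filter (fun j : Fin N => ‖y j - z‖ < r)).card}

/-- The normalized kNN bandwidth `ρ̂(z) = R̂(z) ((1 / m₀[h]) (k / N))^(-1/d)`, where `h` is the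
indicator function of `[0, 1)`. -/
def knnBandwidth (d : ℕ) {D N : ℕ} (k : ℕ) (y : Fin N → EuclideanSpace ℝ (Fin D))
    (z : EuclideanSpace ℝ (Fin D)) : ℝ :=
  knnRadius k y z *
    (1 / m0 d (Set.indicator (Set.Ico 0 1) 1) * ((k : ℝ) / (N : ℝ))) ^ (-1 / (d : ℝ))

/-- The population bandwidth `ρ̄ = p^(-1/d)`. -/
def populationBandwidth {M : Type*} (d : ℕ) (p : M → ℝ) (x : M) : ℝ :=
  p x ^ (-1 / (d : ℝ))

/-- The uniform relative error `sup_{x ∈ M} |ρ̂(x) - ρ̄(x)| / ρ̄(x)` of the bandwidth built from the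
sample `Y`, as a supremum in `[0, ∞]`. -/
def supRelativeError {M : Type*} (d : ℕ) {D N : ℕ} (ι : M → EuclideanSpace ℝ (Fin D))
    (p : M → ℝ) (k : ℕ) (Y : Fin N → M) : ℝ≥0∞ :=
  ⨆ x : M, ENNReal.ofReal
    (|knnBandwidth d k (fun j => ι (Y j)) (ι x) - populationBandwidth d p x|
      / populationBandwidth d p x)

end

/-! ### Jacobians of maps that are close to an isometry -/

section JacobianAlgebra

variable {E F : Type*} [NormedAddCommGroup E] [InnerProductSpace ℝ E] [FiniteDimensional ℝ E]
  [NormedAddCommGroup F] [InnerProductSpace ℝ F] [FiniteDimensional ℝ F]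

/-! The law of a sample gives the extrinsic ball of radius `r` at `x` the mass `m p(x) r^d (1 +
O(r²))`, uniformly in `x`, where `m` is the volume of the unit ball. Put `a = (k / (m N))^(1/d)`.
Then the radius `a ρ̄(x)` has expected count `k (1 + O(a²))`, and the relative error of `ρ̂` at `x`
is `|R̂(x) / (a ρ̄(x)) - 1|`. Changing the radius by a factor `1 ± η` changes the expected count by
about `1 ± dη`; this is the source of the `1/d` in the stochastic term. The bias `O(a²)` is the term
`(k/N)^(2/d)`.

The mass expansion is obtained by projecting a patch orthogonally onto the tangent space at `x`.
Three errors must be of second order. The normal displacement is quadratic in the tangential one, so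
by Pythagoras the projected ball lies between balls of radii `r (1 - O(r²))` and `r`. The Jacobian
of the projection differs from the volume density by a factor `1 + O(r²)`, because a perturbation
normal to an isometry enters the Gram operator only quadratically (`exists_normDet_eq_abs_det_mul`).
The density is affine up to `O(r²)`, and its linear part integrates to zero over a centred ball
(`setLIntegral_ball_ofReal_affine`). These combine in `IsImmersedPatch.setLIntegral_bounds`;
independence of the chart and compactness give `exists_hasBallExpansionOn_univ`.

For the fluctuations, Chernoff bounds with relative deviation `δ = 9 √(log N / k)` control the
counts in the balls of radii `a ρ̄ (1 ± η)` at one point, with failure probability at most `2 N⁻¹⁵`.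
A union bound over an `a³`-net, which has at most `N⁴` points by a packing argument
(`exists_finset_net`), makes this simultaneous. Passing from the net to all of `M` costs `O(a²)`
(`relativeError_le_of_counts`), which joins the bias. -/

lemma exists_abs_det_one_add_sub_one_le :
    ∃ K ρ : ℝ, 0 < K ∧ 0 < ρ ∧ ∀ X : E →L[ℝ] E, ‖X‖ < ρ →
      |(1 + X : E →L[ℝ] E).det - 1| ≤ K * ‖X‖ := by
  classical
  have hdet : ContDiff ℝ 1 (fun X : E →L[ℝ] E => X.det) := by
    let b := stdOrthonormalBasis ℝ E
    have h1 : (fun X : E →L[ℝ] E => X.det) = fun X : E →L[ℝ] E =>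
        (Matrix.of fun i j => inner ℝ (b i) (X (b j))).det := by
      funext X
      rw [ContinuousLinearMap.det, ← LinearMap.det_toMatrix b.toBasis]
      congr 1
      ext i j
      simp [LinearMap.toMatrix_apply, b.repr_apply_apply]
    rw [h1]
    simp only [Matrix.det_apply, Matrix.of_apply]
    refine ContDiff.sum fun σ _ => ContDiff.const_smul _ (contDiff_prod fun i _ => ?_)
    exact contDiff_const.inner ℝ (contDiff_id.clm_apply contDiff_const)
  obtain ⟨K, t, ht, hK⟩ := (hdet.contDiffAt (x := (1 : E →L[ℝ] E))).exists_lipschitzOnWith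
  obtain ⟨ρ, hρ, hball⟩ := Metric.mem_nhds_iff.1 ht
  refine ⟨K + 1, ρ, by positivity, hρ, fun X hX => ?_⟩
  have h1 : (1 + X : E →L[ℝ] E) ∈ t := hball (by simpa [dist_eq_norm] using hX)
  have h2 : (1 : E →L[ℝ] E) ∈ t := hball (Metric.mem_ball_self hρ)
  have h3 := hK.dist_le_mul _ h1 _ h2
  have h4 : (1 : E →L[ℝ] E).det = 1 := by simp [ContinuousLinearMap.det]
  rw [Real.dist_eq, dist_eq_norm, h4, add_sub_cancel_left] at h3
  nlinarith [norm_nonneg X]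

lemma LinearIsometry.adjoint_apply_self (J : E →ₗᵢ[ℝ] F) (x : E) :
    J.toContinuousLinearMap.adjoint (J x) = x := by
  refine ext_inner_right ℝ fun y => ?_
  rw [ContinuousLinearMap.adjoint_inner_left]
  simp

/-- Pythagoras for the orthogonal projection `J J†` onto the range of an isometry. -/
lemma LinearIsometry.norm_sq_eq_adjoint (J : E →ₗᵢ[ℝ] F) (y : F) :
    ‖y‖ ^ 2 = ‖J.toContinuousLinearMap.adjoint y‖ ^ 2
      + ‖y - J (J.toContinuousLinearMap.adjoint y)‖ ^ 2 := by
  set w := J.toContinuousLinearMap.adjoint y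
  have h0 : inner ℝ (J w) (y - J w) = 0 := by
    rw [inner_sub_right, J.inner_map_map]
    have : inner ℝ (J w) y = inner ℝ w w :=
      (ContinuousLinearMap.adjoint_inner_right J.toContinuousLinearMap w y).symm
    rw [this, sub_self]
  have := norm_add_sq_eq_norm_sq_add_norm_sq_of_inner_eq_zero (J w) (y - J w) h0
  rw [add_sub_cancel, J.norm_map] at this
  simpa [sq] using this

lemma LinearIsometry.norm_adjoint_le (J : E →ₗᵢ[ℝ] F) (y : F) :
    ‖J.toContinuousLinearMap.adjoint y‖ ≤ ‖y‖ := by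
  have := J.norm_sq_eq_adjoint y
  exact le_of_sq_le_sq (by nlinarith [sq_nonneg ‖y - J (J.toContinuousLinearMap.adjoint y)‖])
    (norm_nonneg _)

lemma LinearIsometry.norm_sub_adjoint_le (J : E →ₗᵢ[ℝ] F) (y : F) (z : E) :
    ‖y - J (J.toContinuousLinearMap.adjoint y)‖ ≤ ‖y - J z‖ := by
  have h := J.norm_sq_eq_adjoint (y - J z)
  rw [map_sub, J.adjoint_apply_self, map_sub] at h
  have h2 : y - J z - (J (J.toContinuousLinearMap.adjoint y) - J z)
    = y - J (J.toContinuousLinearMap.adjoint y) := by abel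
  rw [h2] at h
  refine le_of_sq_le_sq ?_ (norm_nonneg _)
  nlinarith [sq_nonneg ‖J.toContinuousLinearMap.adjoint y - z‖]

/-- The cross terms of the Gram operator of `J + Z` vanish because `Z` is normal to the range of
`J`, leaving `1 + Z†Z`. Hence the error is quadratic in `‖Z‖`; a linear error would spoil the rate.
-/
lemma abs_normDet_isometry_add_sub_one_le :
    ∃ K ρ : ℝ, 0 < K ∧ 0 < ρ ∧ ∀ (J : E →ₗᵢ[ℝ] F) (Z : E →L[ℝ] F),
      (∀ w, J.toContinuousLinearMap.adjoint (Z w) = 0) → ‖Z‖ < ρ →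
      |(J.toContinuousLinearMap + Z).toLinearMap.normDet - 1| ≤ K * ‖Z‖ ^ 2 := by
  obtain ⟨K, ρ, hK, hρ, h⟩ := exists_abs_det_one_add_sub_one_le (E := E)
  refine ⟨K, min 1 ρ, hK, by positivity, fun J Z hZ hn => ?_⟩
  have h1 := ContinuousLinearMap.normDet_sq (𝕜 := ℝ) (J.toContinuousLinearMap + Z)
  have h2 : (J.toContinuousLinearMap + Z).adjoint ∘L (J.toContinuousLinearMap + Z)
      = 1 + Z.adjoint ∘L Z := by
    refine ContinuousLinearMap.ext fun x => ext_inner_right ℝ fun y => ?_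
    have e1 : inner ℝ (J x) (Z y) = 0 := by
      have := ContinuousLinearMap.adjoint_inner_right J.toContinuousLinearMap x (Z y)
      rw [hZ, inner_zero_right] at this
      exact this.symm
    have e2 : inner ℝ (Z x) (J y) = 0 := by
      have := ContinuousLinearMap.adjoint_inner_left J.toContinuousLinearMap y (Z x)
      rw [hZ, inner_zero_left] at this
      exact this.symm
    simp only [ContinuousLinearMap.comp_apply, ContinuousLinearMap.adjoint_inner_left,
      add_apply, inner_add_left, inner_add_right,
      LinearIsometry.coe_toContinuousLinearMap, one_apply_eq_self, e1, e2,
      LinearIsometry.inner_map_map]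
    ring
  rw [h2] at h1
  have hn1 : ‖Z‖ < 1 := hn.trans_le (min_le_left _ _)
  have hn2 : ‖Z‖ < ρ := hn.trans_le (min_le_right _ _)
  have h3 : ‖Z.adjoint ∘L Z‖ = ‖Z‖ ^ 2 := by
    rw [ContinuousLinearMap.norm_adjoint_comp_self, sq]
  have h4 := h (Z.adjoint ∘L Z) (by rw [h3]; nlinarith [norm_nonneg Z])
  rw [h3, ← h1] at h4
  set j := (J.toContinuousLinearMap + Z).toLinearMap.normDet
  have hj : 0 ≤ j := LinearMap.normDet_nonneg _
  refine le_trans ?_ h4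
  -- Since `j ≥ 0`, the factor `j + 1` is at least `1`, so `|j - 1| ≤ |j² - 1|` and no square root
  -- has to be estimated.
  have : ((j ^ 2 : ℝ) : ℝ) - 1 = (j - 1) * (j + 1) := by ring
  simp only [RCLike.ofReal_real_eq_id, id]
  rw [this, abs_mul, abs_of_nonneg (by linarith : 0 ≤ j + 1)]
  nlinarith [abs_nonneg (j - 1)]

lemma ContinuousLinearMap.exists_equiv_of_lower_bound (S : E →L[ℝ] E) {s : ℝ} (hs : 0 < s)
    (hS : ∀ w, s * ‖w‖ ≤ ‖S w‖) :
    ∃ R : E ≃L[ℝ] E, (∀ w, R w = S w) ∧ ∀ w, ‖R.symm w‖ ≤ s⁻¹ * ‖w‖ := by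
  have hinj : Function.Injective S.toLinearMap := by
    rw [← LinearMap.ker_eq_bot, LinearMap.ker_eq_bot']
    intro w hw
    have := hS w
    rw [show S w = 0 from hw, norm_zero] at this
    exact norm_le_zero_iff.1 (by nlinarith [norm_nonneg w])
  let R : E ≃ₗ[ℝ] E := LinearEquiv.ofInjectiveEndo S.toLinearMap hinj
  refine ⟨R.toContinuousLinearEquiv, fun w => rfl, fun w => ?_⟩
  have := hS (R.symm w)
  rw [show S (R.symm w) = w from R.apply_symm_apply w] at this
  rw [inv_mul_eq_div, le_div_iff₀ hs, mul_comm]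
  exact this

/-- The Jacobian of `T` factors through an isometry `J` with small normal component. -/
lemma exists_normDet_eq_abs_det_mul :
    ∃ K ρ : ℝ, 0 < K ∧ 0 < ρ ∧ ∀ (J : E →ₗᵢ[ℝ] F) (T : E →L[ℝ] F) (s e : ℝ), 0 < s → 0 ≤ e →
      e / s < ρ →
      (∀ w, s * ‖w‖ ≤ ‖J.toContinuousLinearMap.adjoint (T w)‖) →
      (∀ w, ‖T w - J (J.toContinuousLinearMap.adjoint (T w))‖ ≤ e * ‖w‖) →
      ∃ j : ℝ, 0 ≤ j ∧ T.toLinearMap.normDet = |(J.toContinuousLinearMap.adjoint ∘L T).det| * j ∧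
        |j - 1| ≤ K * (e / s) ^ 2 := by
  obtain ⟨K, ρ, hK, hρ, h⟩ := abs_normDet_isometry_add_sub_one_le (E := E) (F := F)
  refine ⟨K, ρ, hK, hρ, fun J T s e hs he hes hS hT => ?_⟩
  set S : E →L[ℝ] E := J.toContinuousLinearMap.adjoint ∘L T with hSdef
  have hSapp : ∀ w, S w = J.toContinuousLinearMap.adjoint (T w) := fun w => rfl
  obtain ⟨R, hRS, hRn⟩ := S.exists_equiv_of_lower_bound hs hS
  have hR : ∀ w, S (R.symm w) = w := fun w => by rw [← hRS, R.apply_symm_apply]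
  -- The normal part of `T`, transported by `S⁻¹`: then `T = (J + Z) S` with `J†Z = 0`, and the
  -- Jacobian is multiplicative.
  let Z : E →L[ℝ] F := (T - J.toContinuousLinearMap ∘L S) ∘L R.symm.toContinuousLinearMap
  have hZapp : ∀ w, Z w = T (R.symm w) - J (S (R.symm w)) := fun w => rfl
  have hZ : ‖Z‖ ≤ e / s := by
    refine ContinuousLinearMap.opNorm_le_bound _ (by positivity) fun w => ?_
    rw [hZapp]
    refine (hT _).trans ?_
    calc e * ‖R.symm w‖ ≤ e * (s⁻¹ * ‖w‖) := by gcongr; exact hRn w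
      _ = e / s * ‖w‖ := by ring
  refine ⟨(J.toContinuousLinearMap + Z).toLinearMap.normDet, LinearMap.normDet_nonneg _, ?_, ?_⟩
  · have hcomp : T.toLinearMap = (J.toContinuousLinearMap + Z).toLinearMap ∘ₗ S.toLinearMap := by
      refine LinearMap.ext fun w => ?_
      have hw : R.symm (S w) = w := by rw [← hRS, R.symm_apply_apply]
      change T w = J (S w) + Z (S w)
      rw [hZapp, hw]
      abel
    rw [hcomp, LinearMap.normDet_comp_of_finrank_eq _ _ rfl, LinearMap.normDet_eq_abs_det,
      mul_comm]
  · refine (h J Z (fun w => ?_) (hZ.trans_lt hes)).trans ?_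
    · rw [hZapp, map_sub, J.adjoint_apply_self, hSapp, sub_self]
    · gcongr

/-- An injective linear map has the same range as some linear isometry. -/
lemma exists_linearIsometry_range_eq (A : E →L[ℝ] F) (hA : Function.Injective A) :
    ∃ J : E →ₗᵢ[ℝ] F, ∀ w, J (J.toContinuousLinearMap.adjoint (A w)) = A w := by
  let V := A.toLinearMap.range
  have hV : Module.finrank ℝ V = Module.finrank ℝ E := LinearMap.finrank_range_of_inj hA
  let e : E ≃ₗᵢ[ℝ] V := (stdOrthonormalBasis ℝ E).equiv
    ((stdOrthonormalBasis ℝ V)) (finCongr hV.symm)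
  refine ⟨V.subtypeₗᵢ.comp e.toLinearIsometry, fun w => ?_⟩
  obtain ⟨z, hz⟩ : ∃ z, (V.subtypeₗᵢ.comp e.toLinearIsometry) z = A w :=
    ⟨e.symm ⟨A w, LinearMap.mem_range_self _ w⟩, by simp⟩
  rw [← hz, LinearIsometry.adjoint_apply_self]

end JacobianAlgebra

/-! ### Taylor estimates with Lipschitz derivative -/

section LocalExpansion

variable {E G : Type*} [NormedAddCommGroup E] [InnerProductSpace ℝ E]
  [NormedAddCommGroup G] [NormedSpace ℝ G]

/-- `f` has derivative `f'` on `B`, and `f'` is `K`-Lipschitz there. -/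
def HasLipschitzDerivOn (f : E → G) (f' : E → E →L[ℝ] G) (B : Set E) (K : ℝ) : Prop :=
  (∀ v ∈ B, HasFDerivAt f (f' v) v) ∧ ∀ v ∈ B, ∀ w ∈ B, ‖f' v - f' w‖ ≤ K * ‖v - w‖

lemma HasLipschitzDerivOn.mono {f : E → G} {f' : E → E →L[ℝ] G} {B B' : Set E} {K K' : ℝ}
    (h : HasLipschitzDerivOn f f' B K) (hB : B' ⊆ B) (hK : K ≤ K') :
    HasLipschitzDerivOn f f' B' K' :=
  ⟨fun v hv => h.1 v (hB hv), fun v hv w hw => (h.2 v (hB hv) w (hB hw)).trans (by gcongr)⟩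

lemma HasLipschitzDerivOn.norm_sub_sub_le {f : E → G} {f' : E → E →L[ℝ] G} {B : Set E} {K δ : ℝ}
    (h : HasLipschitzDerivOn f f' B K) (hB : Convex ℝ B) (hK : 0 ≤ K) {u v w : E} (hu : u ∈ B)
    (hv : v ∈ B) (hw : w ∈ B) (hδ : ∀ x ∈ B, ‖x - u‖ ≤ δ) :
    ‖f v - f w - f' u (v - w)‖ ≤ K * δ * ‖v - w‖ := by
  refine hB.norm_image_sub_le_of_norm_hasFDerivWithin_le' (f' := f')
    (fun x hx => (h.1 x hx).hasFDerivWithinAt) (fun x hx => ?_) hw hv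
  exact (h.2 x hx u hu).trans (by gcongr; exact hδ x hx)

lemma HasLipschitzDerivOn.norm_sub_sub_le_sq {f : E → G} {f' : E → E →L[ℝ] G} {B : Set E} {K : ℝ}
    (h : HasLipschitzDerivOn f f' B K) (hB : Convex ℝ B) (hK : 0 ≤ K) {u v : E} (hu : u ∈ B)
    (hv : v ∈ B) : ‖f v - f u - f' u (v - u)‖ ≤ K * ‖v - u‖ ^ 2 := by
  -- Cutting `B` down to the ball of radius `‖v - u‖` turns the diameter factor `δ` of the mean
  -- value estimate into the second power.
  have h' := h.mono (B' := B ∩ Metric.closedBall u ‖v - u‖) (K' := K) Set.inter_subset_left le_rfl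
  have := h'.norm_sub_sub_le (u := u) (v := v) (w := u) (δ := ‖v - u‖)
    (hB.inter (convex_closedBall _ _)) hK ⟨hu, by simp⟩ ⟨hv, by simp [dist_eq_norm]⟩
    ⟨hu, by simp⟩ (fun x hx => by simpa [dist_eq_norm] using hx.2)
  rwa [mul_assoc, ← sq] at this

lemma ContDiffAt.exists_hasLipschitzDerivOn {f : E → G} {u₀ : E} (hf : ContDiffAt ℝ 2 f u₀) :
    ∃ K η : ℝ, 0 < K ∧ 0 < η ∧ HasLipschitzDerivOn f (fderiv ℝ f) (Metric.ball u₀ η) K := by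
  have h1 : ContDiffAt ℝ 1 (fderiv ℝ f) u₀ := hf.fderiv_right (by norm_num)
  obtain ⟨K, t, ht, hK⟩ := h1.exists_lipschitzOnWith
  have h2 : ∀ᶠ v in 𝓝 u₀, ContDiffAt ℝ 2 f v := hf.eventually (by simp)
  obtain ⟨η, hη, hball⟩ := Metric.mem_nhds_iff.1 (Filter.inter_mem ht h2)
  refine ⟨K + 1, η, by positivity, hη, fun v hv => ?_, fun v hv w hw => ?_⟩
  · have h3 : ContDiffAt ℝ 2 f v := (hball hv).2
    exact (h3.differentiableAt (by norm_num)).hasFDerivAt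
  · have := hK.dist_le_mul _ (hball hv).1 _ (hball hw).1
    rw [dist_eq_norm, dist_eq_norm] at this
    nlinarith [norm_nonneg (v - w)]

/-- The linear part is odd and the ball is symmetric. This cancellation removes the first-order term
from the ball mass. -/
lemma setLIntegral_ball_ofReal_affine [FiniteDimensional ℝ E] [MeasurableSpace E] [BorelSpace E]
    (c : ℝ) (ℓ : E →L[ℝ] ℝ)
    {t : ℝ} (ht : 0 < t) (hpos : ∀ z ∈ Metric.ball (0 : E) t, 0 ≤ c + ℓ z) :
    ∫⁻ z in Metric.ball (0 : E) t, ENNReal.ofReal (c + ℓ z)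
      = ENNReal.ofReal (c * (t ^ Module.finrank ℝ E * volume.real (Metric.ball (0 : E) 1))) := by
  have hint : IntegrableOn (fun z => c + ℓ z) (Metric.ball (0 : E) t) :=
    ((by fun_prop : Continuous fun z => c + ℓ z).continuousOn.integrableOn_compact
      (isCompact_closedBall 0 t)).mono_set Metric.ball_subset_closedBall
  have hintℓ : IntegrableOn (fun z => ℓ z) (Metric.ball (0 : E) t) :=
    (ℓ.continuous.continuousOn.integrableOn_compact
      (isCompact_closedBall 0 t)).mono_set Metric.ball_subset_closedBall
  rw [← ofReal_integral_eq_lintegral_ofReal hint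
    ((ae_restrict_iff' measurableSet_ball).2 (ae_of_all _ hpos))]
  congr 1
  have hodd : ∫ z in Metric.ball (0 : E) t, ℓ z = 0 := by
    have h1 : ∫ z in Metric.ball (0 : E) t, ℓ z = ∫ z in Metric.ball (0 : E) t, ℓ (-z) := by
      rw [← integral_indicator measurableSet_ball, ← integral_indicator measurableSet_ball,
        ← integral_neg_eq_self]
      refine integral_congr_ae (ae_of_all _ fun z => ?_)
      simp [Set.indicator]
    have h2 : ∫ z in Metric.ball (0 : E) t, ℓ (-z) = - ∫ z in Metric.ball (0 : E) t, ℓ z := by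
      simp [integral_neg]
    linarith
  have hconst : IntegrableOn (fun _ : E => c) (Metric.ball (0 : E) t) :=
    integrableOn_const measure_ball_lt_top.ne
  rw [integral_add hconst hintℓ, hodd, add_zero,
    setIntegral_const, smul_eq_mul, mul_comm]
  congr 1
  rw [measureReal_def, measureReal_def, Measure.addHaar_ball_of_pos _ _ ht, ENNReal.toReal_mul,
    ENNReal.toReal_ofReal (by positivity)]

end LocalExpansion

/-! ### Immersed patches and their tangent coordinates -/

section Patch

variable {E F : Type*} [NormedAddCommGroup E] [InnerProductSpace ℝ E] [NormedAddCommGroup F] [InnerProductSpace ℝ F]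

/-- Quantitative immersion data for `ψ` on the ball of radius `η` around `u₀`. -/
structure IsImmersedPatch (ψ : E → F) (ψ' : E → E →L[ℝ] F) (u₀ : E) (η K s : ℝ) : Prop where
  deriv : HasLipschitzDerivOn ψ ψ' (Metric.ball u₀ η) K
  K_nonneg : 0 ≤ K
  s_pos : 0 < s
  lower : ∀ v ∈ Metric.ball u₀ η, ∀ w, s * ‖w‖ ≤ ‖ψ' v w‖
  small : 4 * K * η ≤ s

lemma ContDiffAt.exists_isImmersedPatch [FiniteDimensional ℝ E] {ψ : E → F} {u₀ : E}
    (hψ : ContDiffAt ℝ 2 ψ u₀) (hinj : Function.Injective (fderiv ℝ ψ u₀)) :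
    ∃ K s η₀ : ℝ, 0 < K ∧ 0 < s ∧ 0 < η₀ ∧ ∀ η, η ≤ η₀ →
      IsImmersedPatch ψ (fderiv ℝ ψ) u₀ η K s := by
  obtain ⟨K, η₁, hK, hη₁, h⟩ := hψ.exists_hasLipschitzDerivOn
  obtain ⟨c, hc, hanti⟩ := LinearMap.exists_antilipschitzWith (fderiv ℝ ψ u₀).toLinearMap
    (LinearMap.ker_eq_bot.2 hinj)
  have hlow : ∀ w, (c : ℝ)⁻¹ * ‖w‖ ≤ ‖fderiv ℝ ψ u₀ w‖ := fun w => by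
    have := hanti.le_mul_dist w 0
    simp only [dist_zero_right, map_zero, ContinuousLinearMap.coe_coe] at this
    rwa [inv_mul_le_iff₀ (by exact_mod_cast hc)]
  have hc' : (0 : ℝ) < (c : ℝ)⁻¹ := inv_pos.2 (by exact_mod_cast hc)
  set a := (c : ℝ)⁻¹
  -- With `8 K η ≤ a` the derivative moves by less than `a / 2` from the centre, so half of the
  -- lower bound `a` survives, and `4 K η ≤ a / 2` is the smallness condition for `s = a / 2`.
  refine ⟨K, a / 2, min η₁ (a / (8 * K)), hK, by positivity, by positivity, fun η hη => ?_⟩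
  have h1 : η ≤ η₁ := hη.trans (min_le_left _ _)
  have h2 : η * (8 * K) ≤ a := by
    have := hη.trans (min_le_right _ _)
    rwa [le_div_iff₀ (by positivity)] at this
  refine ⟨h.mono (Metric.ball_subset_ball h1) le_rfl, hK.le, by positivity, fun v hv w => ?_,
    by linarith⟩
  have h3 : ‖fderiv ℝ ψ v - fderiv ℝ ψ u₀‖ ≤ a / 2 := by
    refine (h.2 v (Metric.ball_subset_ball h1 hv) u₀ (Metric.mem_ball_self hη₁)).trans ?_
    have : ‖v - u₀‖ ≤ η := by simpa [dist_eq_norm] using (Metric.mem_ball.1 hv).le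
    nlinarith
  have h4 := (fderiv ℝ ψ v - fderiv ℝ ψ u₀).le_of_opNorm_le h3 w
  have h5 := norm_sub_norm_le (fderiv ℝ ψ u₀ w) (fderiv ℝ ψ v w)
  rw [norm_sub_rev (fderiv ℝ ψ u₀ w)] at h5
  have h6 : (fderiv ℝ ψ v - fderiv ℝ ψ u₀) w = fderiv ℝ ψ v w - fderiv ℝ ψ u₀ w := rfl
  rw [h6] at h4
  linarith [hlow w]

namespace IsImmersedPatch

variable {ψ : E → F} {ψ' : E → E →L[ℝ] F} {u₀ u v w : E} {η K s : ℝ}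

omit [InnerProductSpace ℝ E] in
lemma norm_sub_le (hu : u ∈ Metric.ball u₀ η) {x : E} (hx : x ∈ Metric.ball u₀ η) :
    ‖x - u‖ ≤ 2 * η := by
  rw [← dist_eq_norm]
  have h1 := Metric.mem_ball.1 hu
  have h2 := Metric.mem_ball'.1 hx
  have := dist_triangle_right x u u₀
  rw [dist_comm x u₀] at this
  linarith

/-- Two points of the patch are at distance at most `2 η`, and `4 K η ≤ s` makes the oscillation of
the derivative at most `s / 2`. Half of the expansion factor `s` is thus kept throughout the patch,
whichever base point is used for linearisation. -/
lemma norm_image_sub_sub_le (P : IsImmersedPatch ψ ψ' u₀ η K s) (hu : u ∈ Metric.ball u₀ η)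
    (hv : v ∈ Metric.ball u₀ η) (hw : w ∈ Metric.ball u₀ η) :
    ‖ψ v - ψ w - ψ' u (v - w)‖ ≤ s / 2 * ‖v - w‖ := by
  refine (P.deriv.norm_sub_sub_le (convex_ball _ _) P.K_nonneg hu hv hw
    (fun x hx => norm_sub_le hu hx)).trans ?_
  have := P.small
  gcongr
  linarith

lemma norm_deriv_sub_le (P : IsImmersedPatch ψ ψ' u₀ η K s) (hu : u ∈ Metric.ball u₀ η)
    (hv : v ∈ Metric.ball u₀ η) : ‖ψ' v - ψ' u‖ ≤ s / 2 := by
  refine (P.deriv.2 v hv u hu).trans ?_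
  have h1 := P.small
  have h2 := norm_sub_le hu hv
  nlinarith [P.K_nonneg]

/-- A patch is expanding up to the factor `s / 2`. -/
lemma le_norm_image_sub (P : IsImmersedPatch ψ ψ' u₀ η K s)
    (hv : v ∈ Metric.ball u₀ η) (hw : w ∈ Metric.ball u₀ η) :
    s / 2 * ‖v - w‖ ≤ ‖ψ v - ψ w‖ := by
  have h1 := P.norm_image_sub_sub_le hv hv hw
  have h2 := P.lower v hv (v - w)
  have h3 := norm_sub_norm_le (ψ' v (v - w)) (ψ v - ψ w)
  rw [norm_sub_rev (ψ' v (v - w))] at h3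
  linarith

variable [FiniteDimensional ℝ E] [FiniteDimensional ℝ F] {J : E →ₗᵢ[ℝ] F}

/-- The coordinate along the tangent space at `ψ u`, framed by the isometry `J`. -/
noncomputable def tangentCoord (ψ : E → F) (J : E →ₗᵢ[ℝ] F) (u v : E) : E :=
  J.toContinuousLinearMap.adjoint (ψ v - ψ u)

lemma hasFDerivAt_tangentCoord (P : IsImmersedPatch ψ ψ' u₀ η K s)
    (hv : v ∈ Metric.ball u₀ η) :
    HasFDerivAt (tangentCoord ψ J u) (J.toContinuousLinearMap.adjoint ∘L ψ' v) v :=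
  (J.toContinuousLinearMap.adjoint).hasFDerivAt.comp v ((P.deriv.1 v hv).sub_const (ψ u))

lemma norm_frame_deriv (hJ : ∀ w, J (J.toContinuousLinearMap.adjoint (ψ' u w)) = ψ' u w) (w : E) :
    ‖J.toContinuousLinearMap.adjoint (ψ' u w)‖ = ‖ψ' u w‖ := by
  conv_rhs => rw [← hJ w, J.norm_map]

lemma norm_tangentCoord_sub_sub_le (P : IsImmersedPatch ψ ψ' u₀ η K s)
    (hu : u ∈ Metric.ball u₀ η) (hv : v ∈ Metric.ball u₀ η) (hw : w ∈ Metric.ball u₀ η) :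
    ‖tangentCoord ψ J u v - tangentCoord ψ J u w
      - (J.toContinuousLinearMap.adjoint ∘L ψ' u) (v - w)‖ ≤ s / 2 * ‖v - w‖ := by
  have h : tangentCoord ψ J u v - tangentCoord ψ J u w
      - (J.toContinuousLinearMap.adjoint ∘L ψ' u) (v - w)
      = J.toContinuousLinearMap.adjoint (ψ v - ψ w - ψ' u (v - w)) := by
    simp only [tangentCoord, ContinuousLinearMap.comp_apply, map_sub]
    abel
  rw [h]
  exact (J.norm_adjoint_le _).trans (P.norm_image_sub_sub_le hu hv hw)

lemma le_norm_tangentCoord_sub (P : IsImmersedPatch ψ ψ' u₀ η K s)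
    (hJ : ∀ w, J (J.toContinuousLinearMap.adjoint (ψ' u w)) = ψ' u w)
    (hu : u ∈ Metric.ball u₀ η) (hv : v ∈ Metric.ball u₀ η) (hw : w ∈ Metric.ball u₀ η) :
    s / 2 * ‖v - w‖ ≤ ‖tangentCoord ψ J u v - tangentCoord ψ J u w‖ := by
  have h1 := P.norm_tangentCoord_sub_sub_le (J := J) hu hv hw
  have h2 := P.lower u hu (v - w)
  rw [← norm_frame_deriv hJ] at h2
  have h3 := norm_sub_norm_le ((J.toContinuousLinearMap.adjoint ∘L ψ' u) (v - w))
    (tangentCoord ψ J u v - tangentCoord ψ J u w)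
  rw [norm_sub_rev ((J.toContinuousLinearMap.adjoint ∘L ψ' u) (v - w))] at h3
  rw [ContinuousLinearMap.comp_apply] at h3 h1
  linarith

@[simp] lemma tangentCoord_self : tangentCoord ψ J u u = 0 := by simp [tangentCoord]

lemma norm_sub_le_tangentCoord (P : IsImmersedPatch ψ ψ' u₀ η K s)
    (hJ : ∀ w, J (J.toContinuousLinearMap.adjoint (ψ' u w)) = ψ' u w)
    (hu : u ∈ Metric.ball u₀ η) (hv : v ∈ Metric.ball u₀ η) :
    ‖v - u‖ ≤ 2 / s * ‖tangentCoord ψ J u v‖ := by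
  have h := P.le_norm_tangentCoord_sub hJ hu hv hu
  rw [tangentCoord_self, sub_zero] at h
  have := P.s_pos
  rw [div_mul_eq_mul_div, le_div_iff₀ this]
  linarith

/-- Pythagoras, where the normal component is at most the second-order Taylor remainder, since `ψ' u
(v - u)` is tangent. The correction is of fourth order in the squared norm, hence a relative `O(r²)`
in the radius. -/
lemma norm_image_sub_sq_le (P : IsImmersedPatch ψ ψ' u₀ η K s)
    (hJ : ∀ w, J (J.toContinuousLinearMap.adjoint (ψ' u w)) = ψ' u w)
    (hu : u ∈ Metric.ball u₀ η) (hv : v ∈ Metric.ball u₀ η) :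
    ‖ψ v - ψ u‖ ^ 2 ≤ ‖tangentCoord ψ J u v‖ ^ 2
      + K ^ 2 * (2 / s) ^ 4 * ‖tangentCoord ψ J u v‖ ^ 4 := by
  rw [J.norm_sq_eq_adjoint (ψ v - ψ u)]
  refine add_le_add le_rfl ?_
  have h1 := J.norm_sub_adjoint_le (ψ v - ψ u) (J.toContinuousLinearMap.adjoint (ψ' u (v - u)))
  rw [hJ] at h1
  have h2 := P.deriv.norm_sub_sub_le_sq (convex_ball _ _) P.K_nonneg hu hv
  have h3 := P.norm_sub_le_tangentCoord hJ hu hv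
  have h4 : ‖ψ v - ψ u - J (J.toContinuousLinearMap.adjoint (ψ v - ψ u))‖
      ≤ K * (2 / s * ‖tangentCoord ψ J u v‖) ^ 2 := by
    refine h1.trans (h2.trans ?_)
    have := P.K_nonneg
    gcongr
  calc _ ≤ (K * (2 / s * ‖tangentCoord ψ J u v‖) ^ 2) ^ 2 := by gcongr
    _ = _ := by ring

lemma norm_tangentCoord_le (v : E) : ‖tangentCoord ψ J u v‖ ≤ ‖ψ v - ψ u‖ :=
  J.norm_adjoint_le _

lemma le_norm_frame_deriv (P : IsImmersedPatch ψ ψ' u₀ η K s)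
    (hJ : ∀ w, J (J.toContinuousLinearMap.adjoint (ψ' u w)) = ψ' u w)
    (hu : u ∈ Metric.ball u₀ η) (hv : v ∈ Metric.ball u₀ η) (w : E) :
    s / 2 * ‖w‖ ≤ ‖J.toContinuousLinearMap.adjoint (ψ' v w)‖ := by
  have h1 := P.lower u hu w
  rw [← norm_frame_deriv hJ] at h1
  have h2 := (ψ' v - ψ' u).le_of_opNorm_le (P.norm_deriv_sub_le hu hv) w
  have h3 := J.norm_adjoint_le ((ψ' v - ψ' u) w)
  rw [sub_apply, map_sub] at h3
  rw [sub_apply] at h2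
  have h4 := norm_sub_norm_le (J.toContinuousLinearMap.adjoint (ψ' u w))
    (J.toContinuousLinearMap.adjoint (ψ' v w))
  rw [norm_sub_rev (J.toContinuousLinearMap.adjoint (ψ' u w))] at h4
  linarith

lemma norm_deriv_sub_frame_le (P : IsImmersedPatch ψ ψ' u₀ η K s)
    (hJ : ∀ w, J (J.toContinuousLinearMap.adjoint (ψ' u w)) = ψ' u w)
    (hu : u ∈ Metric.ball u₀ η) (hv : v ∈ Metric.ball u₀ η) (w : E) :
    ‖ψ' v w - J (J.toContinuousLinearMap.adjoint (ψ' v w))‖ ≤ K * ‖v - u‖ * ‖w‖ := by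
  have h1 := J.norm_sub_adjoint_le (ψ' v w) (J.toContinuousLinearMap.adjoint (ψ' u w))
  rw [hJ] at h1
  exact h1.trans ((ψ' v - ψ' u).le_of_opNorm_le (P.deriv.2 v hv u hu) w)

/-- A quantitative inverse function theorem: the coordinate is within `s / 2` of a linear map whose
inverse has norm at most `1 / s`, so the image of a ball of radius `η / 4` about `u` contains a ball
of radius `(s - s / 2) η / 4`. Keeping `u` in the half-radius ball leaves room for this smaller
ball. -/
lemma ball_subset_image_tangentCoord (P : IsImmersedPatch ψ ψ' u₀ η K s)
    (hJ : ∀ w, J (J.toContinuousLinearMap.adjoint (ψ' u w)) = ψ' u w)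
    (hu : u ∈ Metric.ball u₀ (η / 2)) {t : ℝ} (ht : t ≤ s * η / 8) :
    Metric.ball 0 t ⊆ tangentCoord ψ J u '' Metric.ball u₀ η := by
  have hη : 0 < η := by linarith [dist_nonneg.trans_lt (Metric.mem_ball.1 hu)]
  have hu' : u ∈ Metric.ball u₀ η := Metric.ball_subset_ball (by linarith) hu
  have hs := P.s_pos
  let S : E →L[ℝ] E := J.toContinuousLinearMap.adjoint ∘L ψ' u
  obtain ⟨R, hRS, hR⟩ := S.exists_equiv_of_lower_bound hs (fun w => by
    have h2 := P.lower u hu' w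
    rwa [← norm_frame_deriv hJ] at h2)
  let inv : S.NonlinearRightInverse :=
    { toFun := R.symm
      nnnorm := s⁻¹.toNNReal
      bound' := fun y => by rw [Real.coe_toNNReal _ (by positivity)]; exact hR y
      right_inv' := fun y => by rw [← hRS, R.apply_symm_apply] }
  have happ : ApproximatesLinearOn (tangentCoord ψ J u) S (Metric.ball u₀ η) (s / 2).toNNReal :=
    fun x hx y hy => by
      rw [Real.coe_toNNReal _ (by positivity)]
      exact P.norm_tangentCoord_sub_sub_le hu' hx hy
  have hsub : Metric.closedBall u (η / 4) ⊆ Metric.ball u₀ η := fun x hx => by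
    have h1 := Metric.mem_closedBall.1 hx
    have h2 := Metric.mem_ball.1 hu
    have := dist_triangle x u u₀
    rw [Metric.mem_ball]
    linarith
  have hsurj := happ.surjOn_closedBall_of_nonlinearRightInverse inv
    (by positivity : (0 : ℝ) ≤ η / 4) hsub
  rw [tangentCoord_self] at hsurj
  refine Set.Subset.trans (fun z hz => ?_) (hsurj.trans (Set.image_mono hsub))
  rw [Metric.mem_closedBall]
  have h1 := Metric.mem_ball.1 hz
  have h2 : (((inv.nnnorm : ℝ))⁻¹ - (((s / 2).toNNReal : NNReal) : ℝ)) * (η / 4)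
      = s * η / 8 := by
    change ((s⁻¹.toNNReal : ℝ)⁻¹ - ((s / 2).toNNReal : ℝ)) * (η / 4) = _
    rw [Real.coe_toNNReal _ (by positivity), Real.coe_toNNReal _ (by positivity), inv_inv]
    ring
  rw [h2]
  linarith

end IsImmersedPatch

end Patch

/-! ### Mass of a small extrinsic ball inside one patch -/

section PatchMeasure

variable {E F : Type*} [NormedAddCommGroup E] [InnerProductSpace ℝ E] [FiniteDimensional ℝ E]
  [NormedAddCommGroup F] [InnerProductSpace ℝ F] [FiniteDimensional ℝ F]

namespace IsImmersedPatch

variable {ψ : E → F} {ψ' : E → E →L[ℝ] F} {u₀ u v w : E} {η K s : ℝ} {J : E →ₗᵢ[ℝ] F}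

/-- The second-order error of a density in tangent coordinates. -/
noncomputable def densityError (K s Q K₀ : ℝ) : ℝ :=
  (Q * K₀ * (2 * K / s) ^ 2 + K + Q * s⁻¹ * K) * (2 / s) ^ 2

lemma densityError_nonneg {K s Q K₀ : ℝ} (hK : 0 ≤ K) (hs : 0 < s) (hQ : 0 ≤ Q) (hK₀ : 0 ≤ K₀) :
    0 ≤ densityError K s Q K₀ := by unfold densityError; positivity

/-- Three second-order errors add up: the deviation of the Jacobian factor `j` from `1`, the Taylor
remainder of `q`, and the replacement of `v - u` by its linearisation `R⁻¹ z` in the tangent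
coordinate `z`. The factor `(2 / s)²` converts `‖v - u‖` into `‖z‖`. -/
lemma abs_density_sub_le (P : IsImmersedPatch ψ ψ' u₀ η K s)
    (hJ : ∀ w, J (J.toContinuousLinearMap.adjoint (ψ' u w)) = ψ' u w)
    (hu : u ∈ Metric.ball u₀ η) (hv : v ∈ Metric.ball u₀ η)
    {q : E → ℝ} {q' : E → E →L[ℝ] ℝ} (hq : HasLipschitzDerivOn q q' (Metric.ball u₀ η) K)
    {Q : ℝ} (hQ : |q v| ≤ Q) (hQ' : ‖q' u‖ ≤ Q) {R : E ≃L[ℝ] E}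
    (hRS : ∀ w, R w = J.toContinuousLinearMap.adjoint (ψ' u w))
    (hR : ∀ w, ‖R.symm w‖ ≤ s⁻¹ * ‖w‖)
    {j K₀ : ℝ} (hK₀ : 0 ≤ K₀) (hj : |j - 1| ≤ K₀ * (K * ‖v - u‖ / (s / 2)) ^ 2) :
    |j * q v - (q u + q' u (R.symm (tangentCoord ψ J u v)))|
      ≤ densityError K s Q K₀ * ‖tangentCoord ψ J u v‖ ^ 2 := by
  have hs := P.s_pos
  have hK := P.K_nonneg
  have hQ0 : 0 ≤ Q := (abs_nonneg _).trans hQ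
  set z := tangentCoord ψ J u v with hz
  have h1 := P.norm_sub_le_tangentCoord hJ hu hv
  rw [← hz] at h1
  have h2 : ‖q v - q u - q' u (v - u)‖ ≤ K * ‖v - u‖ ^ 2 :=
    hq.norm_sub_sub_le_sq (convex_ball _ _) hK hu hv
  have h3 : ‖v - u - R.symm z‖ ≤ s⁻¹ * (K * ‖v - u‖ ^ 2) := by
    have e1 : v - u - R.symm z = R.symm (R (v - u) - z) := by
      rw [map_sub, R.symm_apply_apply]
    rw [e1]
    refine (hR _).trans ?_
    gcongr
    rw [hRS, hz, tangentCoord, ← map_sub]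
    refine (J.norm_adjoint_le _).trans ?_
    rw [norm_sub_rev]
    exact P.deriv.norm_sub_sub_le_sq (convex_ball _ _) hK hu hv
  have h4 : ‖q' u (v - u - R.symm z)‖ ≤ Q * (s⁻¹ * (K * ‖v - u‖ ^ 2)) :=
    ((q' u).le_of_opNorm_le hQ' _).trans (by gcongr)
  have h5 : |(j - 1) * q v| ≤ K₀ * (K * ‖v - u‖ / (s / 2)) ^ 2 * Q := by
    rw [abs_mul]; gcongr
  have e2 : j * q v - (q u + q' u (R.symm z))
      = (j - 1) * q v + ((q v - q u - q' u (v - u)) + q' u (v - u - R.symm z)) := by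
    rw [map_sub (q' u) (v - u)]; ring
  rw [e2]
  calc _ ≤ K₀ * (K * ‖v - u‖ / (s / 2)) ^ 2 * Q
        + (K * ‖v - u‖ ^ 2 + Q * (s⁻¹ * (K * ‖v - u‖ ^ 2))) :=
        (abs_add_le _ _).trans (add_le_add h5 ((abs_add_le _ _).trans (add_le_add h2 h4)))
    _ = (Q * K₀ * (2 * K / s) ^ 2 + K + Q * s⁻¹ * K) * ‖v - u‖ ^ 2 := by
        field_simp; ring
    _ ≤ (Q * K₀ * (2 * K / s) ^ 2 + K + Q * s⁻¹ * K) * (2 / s * ‖z‖) ^ 2 := by gcongr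
    _ = _ := by rw [densityError]; ring

variable [MeasurableSpace E] [BorelSpace E]

set_option maxHeartbeats 1000000 in
/-- Two-sided bound for the mass that a density gives to a small extrinsic ball. -/
theorem setLIntegral_bounds (P : IsImmersedPatch ψ ψ' u₀ η K s)
    (hu : u ∈ Metric.ball u₀ (η / 2))
    {q : E → ℝ} {q' : E → E →L[ℝ] ℝ} (hq : HasLipschitzDerivOn q q' (Metric.ball u₀ η) K)
    {Q : ℝ} (hQ : ∀ v ∈ Metric.ball u₀ η, |q v| ≤ Q) (hQ' : ∀ v ∈ Metric.ball u₀ η, ‖q' v‖ ≤ Q)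
    {K₀ ρ : ℝ} (hK₀ : 0 ≤ K₀) (hρ : 4 * K * η / s < ρ)
    (hjac : ∀ (J : E →ₗᵢ[ℝ] F) (T : E →L[ℝ] F) (s e : ℝ), 0 < s → 0 ≤ e →
      e / s < ρ →
      (∀ w, s * ‖w‖ ≤ ‖J.toContinuousLinearMap.adjoint (T w)‖) →
      (∀ w, ‖T w - J (J.toContinuousLinearMap.adjoint (T w))‖ ≤ e * ‖w‖) →
      ∃ j : ℝ, 0 ≤ j ∧
        T.toLinearMap.normDet = |(J.toContinuousLinearMap.adjoint ∘L T).det| * j ∧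
        |j - 1| ≤ K₀ * (e / s) ^ 2)
    {r : ℝ} (hr : 0 < r) (hr1 : r ≤ s * η / 8) (hr2 : K ^ 2 * (2 / s) ^ 4 * r ^ 2 < 1)
    (hr3 : Q * s⁻¹ * r + densityError K s Q K₀ * r ^ 2 ≤ q u) :
    ∫⁻ v in {v | v ∈ Metric.ball u₀ η ∧ ‖ψ v - ψ u‖ < r},
        ENNReal.ofReal (ψ' v).toLinearMap.normDet * ENNReal.ofReal (q v)
      ≤ ENNReal.ofReal ((q u + densityError K s Q K₀ * r ^ 2) *
          (r ^ Module.finrank ℝ E * volume.real (Metric.ball (0 : E) 1))) ∧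
    ENNReal.ofReal ((q u - densityError K s Q K₀ * r ^ 2) *
          ((r * (1 - K ^ 2 * (2 / s) ^ 4 * r ^ 2)) ^ Module.finrank ℝ E
            * volume.real (Metric.ball (0 : E) 1)))
      ≤ ∫⁻ v in {v | v ∈ Metric.ball u₀ η ∧ ‖ψ v - ψ u‖ < r},
        ENNReal.ofReal (ψ' v).toLinearMap.normDet * ENNReal.ofReal (q v) := by
  have hη : 0 < η := by linarith [dist_nonneg.trans_lt (Metric.mem_ball.1 hu)]
  have hu' : u ∈ Metric.ball u₀ η := Metric.ball_subset_ball (by linarith) hu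
  have hs := P.s_pos
  have hK := P.K_nonneg
  have hQ0 : 0 ≤ Q := (abs_nonneg _).trans (hQ u hu')
  set C := densityError K s Q K₀ with hC
  have hC0 : 0 ≤ C := densityError_nonneg hK hs hQ0 hK₀
  have hAinj : Function.Injective (ψ' u) := by
    rw [injective_iff_map_eq_zero]
    intro w hw
    have := P.lower u hu' w
    rw [hw, norm_zero] at this
    exact norm_le_zero_iff.1 (by nlinarith [norm_nonneg w])
  obtain ⟨J, hJ⟩ := exists_linearIsometry_range_eq (ψ' u) hAinj
  obtain ⟨R, hRS, hR⟩ := (J.toContinuousLinearMap.adjoint ∘L ψ' u).exists_equiv_of_lower_bound hs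
    (fun w => by
      have h2 := P.lower u hu' w
      rwa [← norm_frame_deriv hJ] at h2)
  have hj : ∀ v ∈ Metric.ball u₀ η, ∃ j : ℝ, 0 ≤ j ∧
      (ψ' v).toLinearMap.normDet = |(J.toContinuousLinearMap.adjoint ∘L ψ' v).det| * j ∧
      |j - 1| ≤ K₀ * (K * ‖v - u‖ / (s / 2)) ^ 2 := fun v hv => by
    refine hjac J (ψ' v) (s / 2) (K * ‖v - u‖) (by positivity) (by positivity) ?_
      (P.le_norm_frame_deriv hJ hu' hv) (P.norm_deriv_sub_frame_le hJ hu' hv)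
    refine lt_of_le_of_lt ?_ hρ
    have := norm_sub_le hu' hv
    rw [div_div_eq_mul_div]
    gcongr ?_ / s
    nlinarith
  set S := {v | v ∈ Metric.ball u₀ η ∧ ‖ψ v - ψ u‖ < r} with hS
  set τ := tangentCoord ψ J u with hτ
  set ℓ : E →L[ℝ] ℝ := q' u ∘L R.symm.toContinuousLinearMap with hℓ
  have hℓapp : ∀ z, ℓ z = q' u (R.symm z) := fun z => rfl
  have hℓn : ∀ z, |ℓ z| ≤ Q * s⁻¹ * ‖z‖ := fun z => by
    rw [hℓapp, mul_assoc]
    exact ((q' u).le_of_opNorm_le (hQ' u hu') _).trans (by gcongr; exact hR z)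
  have hSm : MeasurableSet S := by
    have hc : ContinuousOn (fun v => ‖ψ v - ψ u‖) (Metric.ball u₀ η) := fun v hv =>
      ((P.deriv.1 v hv).continuousAt.sub continuousAt_const).norm.continuousWithinAt
    exact (hc.isOpen_inter_preimage Metric.isOpen_ball isOpen_Iio).measurableSet
  have hinj : Set.InjOn τ S := fun v hv w hw hvw => by
    have := P.le_norm_tangentCoord_sub hJ hu' hv.1 hw.1
    rw [← hτ, hvw, sub_self, norm_zero] at this
    exact sub_eq_zero.1 (norm_le_zero_iff.1 (by nlinarith [norm_nonneg (v - w)]))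
  -- Integrals over `S` are moved to the tangent space, where the density is affine up to `C r²` and
  -- the image lies between two centred balls.
  have hcov : ∀ g : E → ℝ≥0∞, ∫⁻ z in τ '' S, g z
      = ∫⁻ v in S, ENNReal.ofReal |(J.toContinuousLinearMap.adjoint ∘L ψ' v).det| * g (τ v) :=
    fun g => lintegral_image_eq_lintegral_abs_det_fderiv_mul volume hSm
      (fun v hv => (P.hasFDerivAt_tangentCoord hv.1).hasFDerivWithinAt) hinj g
  have hτr : ∀ v ∈ S, ‖τ v‖ < r := fun v hv => (norm_tangentCoord_le v).trans_lt hv.2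
  have hdens : ∀ v ∈ S, ∃ j : ℝ, 0 ≤ j ∧
      (ψ' v).toLinearMap.normDet = |(J.toContinuousLinearMap.adjoint ∘L ψ' v).det| * j ∧
      |j * q v - (q u + ℓ (τ v))| ≤ C * r ^ 2 := fun v hv => by
    obtain ⟨j, hj0, hj1, hj2⟩ := hj v hv.1
    refine ⟨j, hj0, hj1, ?_⟩
    refine (P.abs_density_sub_le hJ hu' hv.1 hq (hQ v hv.1) (hQ' u hu') hRS hR hK₀ hj2).trans ?_
    have := hτr v hv
    gcongr
  constructor
  · calc _ ≤ ∫⁻ v in S, ENNReal.ofReal |(J.toContinuousLinearMap.adjoint ∘L ψ' v).det|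
          * ENNReal.ofReal (q u + C * r ^ 2 + ℓ (τ v)) := by
          refine setLIntegral_mono' hSm fun v hv => ?_
          obtain ⟨j, hj0, hj1, hj2⟩ := hdens v hv
          rw [hj1, ENNReal.ofReal_mul (abs_nonneg _), mul_assoc, ← ENNReal.ofReal_mul hj0]
          gcongr
          linarith [(abs_le.1 hj2).2]
      _ = ∫⁻ z in τ '' S, ENNReal.ofReal (q u + C * r ^ 2 + ℓ z) :=
        (hcov fun z => ENNReal.ofReal (q u + C * r ^ 2 + ℓ z)).symm
      _ ≤ ∫⁻ z in Metric.ball (0 : E) r, ENNReal.ofReal (q u + C * r ^ 2 + ℓ z) := by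
          refine lintegral_mono_set ?_
          rintro _ ⟨v, hv, rfl⟩
          simpa using hτr v hv
      _ = _ := by
          refine setLIntegral_ball_ofReal_affine _ ℓ hr fun z hz => ?_
          have h1 : ‖z‖ < r := by simpa using hz
          have h2 := (abs_le.1 (hℓn z)).1
          have h3 : Q * s⁻¹ * ‖z‖ ≤ Q * s⁻¹ * r := by gcongr
          nlinarith [sq_nonneg r]
  · set a := K ^ 2 * (2 / s) ^ 4 with ha
    have ha0 : 0 ≤ a := by positivity
    -- This inner radius is small enough that the normal displacement cannot push a point out of the
    -- extrinsic ball: `t² (1 + a r²) ≤ r²`, from `(1 - x)² (1 + x) ≤ 1` with `x = a r²`.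
    set t := r * (1 - a * r ^ 2) with ht
    have ht0 : 0 < t := mul_pos hr (by linarith)
    have htr : t ≤ r := by
      rw [ht]; nlinarith [mul_nonneg ha0 (sq_nonneg r)]
    have hsub : Metric.ball (0 : E) t ⊆ τ '' S := fun z hz => by
      obtain ⟨v, hv, hvz⟩ := P.ball_subset_image_tangentCoord hJ hu (htr.trans hr1) hz
      refine ⟨v, ⟨hv, ?_⟩, hvz⟩
      have h1 := P.norm_image_sub_sq_le hJ hu' hv
      have h2 : ‖tangentCoord ψ J u v‖ < t := by rw [hvz]; simpa using hz
      refine lt_of_pow_lt_pow_left₀ 2 hr.le (h1.trans_lt ?_)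
      set y := ‖tangentCoord ψ J u v‖
      have hy : 0 ≤ y := norm_nonneg _
      have h3 : y ^ 2 < t ^ 2 := by gcongr
      have h4 : y ^ 4 ≤ t ^ 2 * r ^ 2 := by
        calc y ^ 4 = y ^ 2 * y ^ 2 := by ring
          _ ≤ t ^ 2 * r ^ 2 := by
            gcongr
            linarith
      have h5 : a * y ^ 4 ≤ a * (t ^ 2 * r ^ 2) := by gcongr
      have h6 : t ^ 2 * (1 + a * r ^ 2) ≤ r ^ 2 := by
        have hx0 : 0 ≤ a * r ^ 2 := by positivity
        rw [ht]
        generalize a * r ^ 2 = x at hr2 hx0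
        have : (1 - x) ^ 2 * (1 + x) ≤ 1 := by nlinarith [mul_nonneg hx0 hx0, sq_nonneg (1 - x)]
        nlinarith [sq_nonneg r]
      nlinarith
    -- Hypothesis `hr3` keeps this affine minorant nonnegative on the ball, so `ENNReal.ofReal` does
    -- not truncate and the odd part still cancels.
    calc _ = ∫⁻ z in Metric.ball (0 : E) t, ENNReal.ofReal (q u - C * r ^ 2 + ℓ z) := by
          refine (setLIntegral_ball_ofReal_affine _ ℓ ht0 fun z hz => ?_).symm
          have h1 : ‖z‖ < r := lt_of_lt_of_le (by simpa using hz) htr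
          have h2 := (abs_le.1 (hℓn z)).1
          have h3 : Q * s⁻¹ * ‖z‖ ≤ Q * s⁻¹ * r := by gcongr
          linarith
      _ ≤ ∫⁻ z in τ '' S, ENNReal.ofReal (q u - C * r ^ 2 + ℓ z) := lintegral_mono_set hsub
      _ = ∫⁻ v in S, ENNReal.ofReal |(J.toContinuousLinearMap.adjoint ∘L ψ' v).det|
          * ENNReal.ofReal (q u - C * r ^ 2 + ℓ (τ v)) :=
        hcov fun z => ENNReal.ofReal (q u - C * r ^ 2 + ℓ z)
      _ ≤ _ := by
          refine setLIntegral_mono' hSm fun v hv => ?_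
          obtain ⟨j, hj0, hj1, hj2⟩ := hdens v hv
          rw [hj1, ENNReal.ofReal_mul (abs_nonneg _), mul_assoc, ← ENNReal.ofReal_mul hj0]
          gcongr
          linarith [(abs_le.1 hj2).1]

end IsImmersedPatch

end PatchMeasure

/-! ### Uniform mass expansion near an immersed point -/

section LocalVolumeExpansion

variable {E F : Type*} [NormedAddCommGroup E] [InnerProductSpace ℝ E] [FiniteDimensional ℝ E]
  [NormedAddCommGroup F] [InnerProductSpace ℝ F] [FiniteDimensional ℝ F]
  [MeasurableSpace E] [BorelSpace E]

set_option maxHeartbeats 1000000 in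
/-- Near an immersed point, an extrinsic ball of radius `r` has mass
`q(u) |B₁| r ^ d (1 + O(r ^ 2))`, uniformly. -/
theorem exists_local_volume_expansion {ψ : E → F} {q : E → ℝ} {u₀ : E}
    (hψ : ContDiffAt ℝ 2 ψ u₀) (hinj : Function.Injective (fderiv ℝ ψ u₀))
    (hq : ContDiffAt ℝ 2 q u₀) (hpos : 0 < q u₀) {U : Set E} (hU : U ∈ 𝓝 u₀) :
    ∃ η L C r₁ : ℝ, 0 < η ∧ 0 ≤ L ∧ 0 ≤ C ∧ 0 < r₁ ∧ Metric.ball u₀ η ⊆ U ∧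
      ∀ u ∈ Metric.ball u₀ (η / 2),
        (∀ r, 0 < r → r < r₁ →
          ∫⁻ v in {v | v ∈ Metric.ball u₀ η ∧ ‖ψ v - ψ u‖ < r},
            ENNReal.ofReal (fderiv ℝ ψ v).toLinearMap.normDet * ENNReal.ofReal (q v)
            ≤ ENNReal.ofReal (volume.real (Metric.ball (0 : E) 1) * q u
                * r ^ Module.finrank ℝ E * (1 + C * r ^ 2)) ∧
          ENNReal.ofReal (volume.real (Metric.ball (0 : E) 1) * q u
                * r ^ Module.finrank ℝ E * (1 - C * r ^ 2))
            ≤ ∫⁻ v in {v | v ∈ Metric.ball u₀ η ∧ ‖ψ v - ψ u‖ < r},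
              ENNReal.ofReal (fderiv ℝ ψ v).toLinearMap.normDet * ENNReal.ofReal (q v)) ∧
        ∀ v ∈ Metric.ball u₀ η, |q v - q u| ≤ L * ‖ψ v - ψ u‖ := by
  -- These constants depend only on the two spaces, so they are available before `η`, which must
  -- satisfy `4 K η / s < ρ`.
  obtain ⟨K₀, ρ, hK₀, hρ, hjac⟩ := exists_normDet_eq_abs_det_mul (E := E) (F := F)
  obtain ⟨K₁, s, η₁, hK₁, hs, hη₁, hP⟩ := hψ.exists_isImmersedPatch hinj
  obtain ⟨K₂, η₂, hK₂, hη₂, hq2⟩ := hq.exists_hasLipschitzDerivOn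
  have hcont : ∀ᶠ v in 𝓝 u₀, q u₀ / 2 < q v ∧ q v < 2 * q u₀ :=
    (hq.continuousAt.eventually (lt_mem_nhds (by linarith))).and
      (hq.continuousAt.eventually (gt_mem_nhds (by linarith)))
  obtain ⟨η₃, hη₃, hball⟩ := Metric.mem_nhds_iff.1 (Filter.inter_mem hU hcont)
  set K := max K₁ K₂ with hK
  have hK0 : 0 < K := lt_max_of_lt_left hK₁
  obtain ⟨η, hη, hle1, hle2, hle3, hle4, hle5, hle6⟩ : ∃ η : ℝ, 0 < η ∧ η ≤ η₁ ∧ η ≤ η₂ ∧ η ≤ η₃ ∧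
      4 * K * η ≤ s ∧ K * η ≤ 1 ∧ 4 * K * η / s < ρ := by
    have h0 : Tendsto (fun η : ℝ => 4 * K * η) (𝓝 0) (𝓝 0) :=
      Continuous.tendsto' (by fun_prop) _ _ (by simp)
    have h1 : Tendsto (fun η : ℝ => K * η) (𝓝 0) (𝓝 0) :=
      Continuous.tendsto' (by fun_prop) _ _ (by simp)
    have h2 : Tendsto (fun η : ℝ => 4 * K * η / s) (𝓝 0) (𝓝 0) :=
      Continuous.tendsto' (by fun_prop) _ _ (by simp)
    have hev : ∀ᶠ η in 𝓝 (0 : ℝ), η ≤ η₁ ∧ η ≤ η₂ ∧ η ≤ η₃ ∧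
        4 * K * η ≤ s ∧ K * η ≤ 1 ∧ 4 * K * η / s < ρ := by
      filter_upwards [eventually_le_nhds hη₁, eventually_le_nhds hη₂, eventually_le_nhds hη₃,
        h0.eventually (eventually_le_nhds hs), h1.eventually (eventually_le_nhds one_pos),
        h2.eventually (eventually_lt_nhds hρ)] with η a b c d e f
      exact ⟨a, b, c, d, e, f⟩
    obtain ⟨η, h, hη⟩ := ((hev.filter_mono nhdsWithin_le_nhds).and
      (self_mem_nhdsWithin : Set.Ioi (0 : ℝ) ∈ 𝓝[>] 0)).exists
    exact ⟨η, hη, h⟩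
  have P : IsImmersedPatch ψ (fderiv ℝ ψ) u₀ η K s := by
    have := hP η hle1
    exact ⟨this.deriv.mono le_rfl (le_max_left _ _), hK0.le, hs, this.lower, hle4⟩
  have hq' : HasLipschitzDerivOn q (fderiv ℝ q) (Metric.ball u₀ η) K :=
    hq2.mono (Metric.ball_subset_ball hle2) (le_max_right _ _)
  have hqb : ∀ v ∈ Metric.ball u₀ η, q u₀ / 2 < q v ∧ q v < 2 * q u₀ := fun v hv =>
    (hball (Metric.ball_subset_ball hle3 hv)).2
  set Q := 2 * q u₀ + ‖fderiv ℝ q u₀‖ + 1 with hQ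
  have hQ0 : 0 < Q := by positivity
  have hQ1 : ∀ v ∈ Metric.ball u₀ η, |q v| ≤ Q := fun v hv => by
    have := hqb v hv
    rw [abs_of_pos (by linarith)]
    linarith [norm_nonneg (fderiv ℝ q u₀)]
  have hQ2 : ∀ v ∈ Metric.ball u₀ η, ‖fderiv ℝ q v‖ ≤ Q := fun v hv => by
    have h1 := hq'.2 v hv u₀ (Metric.mem_ball_self hη)
    have h2 : ‖v - u₀‖ ≤ η := by simpa [dist_eq_norm] using (Metric.mem_ball.1 hv).le
    have h3 := norm_sub_norm_le (fderiv ℝ q v) (fderiv ℝ q u₀)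
    have h4 : K * ‖v - u₀‖ ≤ K * η := by gcongr
    linarith
  set C₂ := IsImmersedPatch.densityError K s Q K₀ with hC₂
  have hC₂0 : 0 ≤ C₂ := IsImmersedPatch.densityError_nonneg hK0.le hs hQ0.le hK₀.le
  set a := K ^ 2 * (2 / s) ^ 4 with ha
  have ha0 : 0 ≤ a := by positivity
  set n := Module.finrank ℝ E with hn
  set m := volume.real (Metric.ball (0 : E) 1) with hm
  have hm0 : 0 ≤ m := measureReal_nonneg
  -- The first term makes the density error relative, using `q ≥ q u₀ / 2` on the patch; the second
  -- is the Bernoulli loss from the `n`-th power of the inner radius factor.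
  set C := C₂ / (q u₀ / 2) + n * a with hC
  have hC0 : 0 ≤ C := by positivity
  obtain ⟨r₁, hr₁, hr⟩ : ∃ r₁ > 0, ∀ r, 0 < r → r < r₁ →
      r ≤ s * η / 8 ∧ a * r ^ 2 < 1 ∧ Q * s⁻¹ * r + C₂ * r ^ 2 ≤ q u₀ / 2 := by
    have h1 : Tendsto (fun r : ℝ => a * r ^ 2) (𝓝 0) (𝓝 0) :=
      Continuous.tendsto' (by fun_prop) _ _ (by simp)
    have h2 : Tendsto (fun r : ℝ => Q * s⁻¹ * r + C₂ * r ^ 2) (𝓝 0) (𝓝 0) :=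
      Continuous.tendsto' (by fun_prop) _ _ (by simp)
    have hev : ∀ᶠ r in 𝓝 (0 : ℝ),
        r ≤ s * η / 8 ∧ a * r ^ 2 < 1 ∧ Q * s⁻¹ * r + C₂ * r ^ 2 ≤ q u₀ / 2 := by
      filter_upwards [eventually_le_nhds (by positivity : 0 < s * η / 8),
        h1.eventually (eventually_lt_nhds one_pos),
        h2.eventually (eventually_le_nhds (by positivity : 0 < q u₀ / 2))] with r x y z
      exact ⟨x, y, z⟩
    obtain ⟨r₁, hr₁, h⟩ := Metric.eventually_nhds_iff.1 hev
    refine ⟨r₁, hr₁, fun r h0 h1 => h ?_⟩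
    rwa [dist_zero_right, Real.norm_eq_abs, abs_of_pos h0]
  refine ⟨η, Q * (2 / s), C, r₁, hη, by positivity, hC0, hr₁,
    fun v hv => (hball (Metric.ball_subset_ball hle3 hv)).1, fun u hu => ⟨fun r h0 h1 => ?_,
      fun v hv => ?_⟩⟩
  · obtain ⟨hr1, hr2, hr3⟩ := hr r h0 h1
    have hu' : u ∈ Metric.ball u₀ η := Metric.ball_subset_ball (by linarith) hu
    have hqu := (hqb u hu').1
    have hqu0 : 0 < q u := by linarith
    obtain ⟨hup, hlow⟩ := P.setLIntegral_bounds hu hq' hQ1 hQ2 hK₀.le hle6 hjac h0 hr1 hr2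
      (hr3.trans hqu.le)
    have hkey : C₂ * r ^ 2 ≤ q u * (C₂ / (q u₀ / 2) * r ^ 2) := by
      have : C₂ * r ^ 2 = (q u₀ / 2) * (C₂ / (q u₀ / 2) * r ^ 2) := by field_simp
      rw [this]
      gcongr
    constructor
    · refine hup.trans (ENNReal.ofReal_le_ofReal ?_)
      have h2 : q u + C₂ * r ^ 2 ≤ q u * (1 + C * r ^ 2) := by
        have : 0 ≤ q u * (n * a * r ^ 2) := by positivity
        rw [hC]; nlinarith
      calc _ ≤ q u * (1 + C * r ^ 2) * (r ^ n * m) := by gcongr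
        _ = _ := by ring
    · refine le_trans (ENNReal.ofReal_le_ofReal ?_) hlow
      have h2 : q u * (1 - C₂ / (q u₀ / 2) * r ^ 2) ≤ q u - C₂ * r ^ 2 := by nlinarith
      have h3 : 0 ≤ q u - C₂ * r ^ 2 := by
        have : 0 ≤ Q * s⁻¹ * r := by positivity
        linarith
      have h4 : 1 - n * (a * r ^ 2) ≤ (1 - a * r ^ 2) ^ n := by
        have := one_add_mul_le_pow (by linarith : (-2 : ℝ) ≤ -(a * r ^ 2)) n
        rw [← sub_eq_add_neg] at this
        linarith
      have h5 : 0 ≤ (1 - a * r ^ 2) ^ n := pow_nonneg (by linarith) _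
      have h6 : q u * (1 - C * r ^ 2) ≤ (q u - C₂ * r ^ 2) * (1 - a * r ^ 2) ^ n := by
        set x := C₂ / (q u₀ / 2) * r ^ 2 with hx
        set y := (n : ℝ) * (a * r ^ 2) with hy
        have hx0 : 0 ≤ x := by positivity
        have hy0 : 0 ≤ y := by positivity
        have e : 1 - C * r ^ 2 = 1 - x - y := by rw [hC, hx, hy]; ring
        rw [e]
        -- If this is negative the claimed lower bound is trivial, so `r` need not be small enough
        -- for `C r² ≤ 1`.
        by_cases hxy : 0 ≤ 1 - x - y
        · have hx1 : 0 ≤ 1 - x := by linarith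
          calc q u * (1 - x - y) ≤ q u * ((1 - x) * (1 - y)) := by
                gcongr; nlinarith
            _ ≤ q u * ((1 - x) * (1 - a * r ^ 2) ^ n) := by gcongr
            _ = q u * (1 - x) * (1 - a * r ^ 2) ^ n := by ring
            _ ≤ _ := by gcongr
        · exact (mul_nonpos_of_nonneg_of_nonpos hqu0.le (by linarith)).trans (mul_nonneg h3 h5)
      calc _ = q u * (1 - C * r ^ 2) * (r ^ n * m) := by ring
        _ ≤ (q u - C₂ * r ^ 2) * (1 - a * r ^ 2) ^ n * (r ^ n * m) := by gcongr
        _ = _ := by rw [mul_pow]; ring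
  · have hu' : u ∈ Metric.ball u₀ η := Metric.ball_subset_ball (by linarith) hu
    have h1 := (convex_ball u₀ η).norm_image_sub_le_of_norm_hasFDerivWithin_le
      (fun x hx => (hq'.1 x hx).hasFDerivWithinAt) hQ2 hu' hv
    have h2 := P.le_norm_image_sub hv hu'
    rw [Real.norm_eq_abs] at h1
    refine h1.trans ?_
    rw [mul_assoc]
    gcongr
    rw [div_mul_eq_mul_div, le_div_iff₀ hs]
    linarith

end LocalVolumeExpansion

noncomputable section

/-! ### The Riemannian volume in charts -/

section Charts

variable {d D : ℕ} {M : Type*} [TopologicalSpace M] [ChartedSpace (EuclideanSpace ℝ (Fin d)) M]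

/-- The inverse of the chart at `x` followed by `ι`. -/
def chartParam (ι : M → EuclideanSpace ℝ (Fin D)) (x : M) :
    EuclideanSpace ℝ (Fin d) → EuclideanSpace ℝ (Fin D) :=
  ι ∘ (chartAt (EuclideanSpace ℝ (Fin d)) x).symm

lemma contDiffAt_comp_chart_symm [IsManifold (𝓡 d) ∞ M] {G : Type*} [NormedAddCommGroup G]
    [NormedSpace ℝ G] {f : M → G} (hf : ContMDiff (𝓡 d) 𝓘(ℝ, G) ∞ f) (x : M)
    {u : EuclideanSpace ℝ (Fin d)} (hu : u ∈ (chartAt (EuclideanSpace ℝ (Fin d)) x).target) :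
    ContDiffAt ℝ ∞ (f ∘ (chartAt (EuclideanSpace ℝ (Fin d)) x).symm) u := by
  rw [← contMDiffAt_iff_contDiffAt]
  have h1 : ContMDiffAt (𝓡 d) (𝓡 d) ∞ (chartAt (EuclideanSpace ℝ (Fin d)) x).symm u :=
    (contMDiffOn_chart_symm (I := 𝓡 d) (n := ∞) (x := x)).contMDiffAt
      ((chartAt (EuclideanSpace ℝ (Fin d)) x).open_target.mem_nhds hu)
  exact (hf _).comp u h1

lemma contDiffAt_chart_transition [IsManifold (𝓡 d) ∞ M]
    {e e' : OpenPartialHomeomorph M (EuclideanSpace ℝ (Fin d))}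
    (he : e ∈ IsManifold.maximalAtlas (𝓡 d) ∞ M) (he' : e' ∈ IsManifold.maximalAtlas (𝓡 d) ∞ M)
    {u : EuclideanSpace ℝ (Fin d)} (hu : u ∈ e.target) (hu' : e.symm u ∈ e'.source) :
    ContDiffAt ℝ ∞ (e' ∘ e.symm) u := by
  rw [← contMDiffAt_iff_contDiffAt]
  have h1 : ContMDiffAt (𝓡 d) (𝓡 d) ∞ e.symm u :=
    (contMDiffOn_symm_of_mem_maximalAtlas he).contMDiffAt (e.open_target.mem_nhds hu)
  have h2 : ContMDiffAt (𝓡 d) (𝓡 d) ∞ e' (e.symm u) :=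
    (contMDiffOn_of_mem_maximalAtlas he').contMDiffAt (e'.open_source.mem_nhds hu')
  exact h2.comp u h1

/-- The derivative of a smooth embedding read in a chart is injective. -/
lemma injective_fderiv_chartParam [IsManifold (𝓡 d) ∞ M] {ι : M → EuclideanSpace ℝ (Fin D)}
    (hι : Manifold.IsSmoothEmbedding (𝓡 d) (𝓡 D) ∞ ι) (x : M)
    {u : EuclideanSpace ℝ (Fin d)} (hu : u ∈ (chartAt (EuclideanSpace ℝ (Fin d)) x).target) :
    Function.Injective (fderiv ℝ (chartParam ι x) u) := by
  set φ := chartAt (EuclideanSpace ℝ (Fin d)) x with hφ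
  set y := φ.symm u with hy
  have him : Manifold.IsImmersionAt (𝓡 d) (𝓡 D) ∞ ι y := hι.isImmersion.isImmersionAt y
  set δ := him.domChart with hδ
  set κ := him.codChart with hκ
  have hyδ : y ∈ δ.source := him.mem_domChart_source
  have hyκ : ι y ∈ κ.source := him.mem_codChart_source
  have hyφ : y ∈ φ.source := φ.map_target hu
  let π : EuclideanSpace ℝ (Fin D) →L[ℝ] EuclideanSpace ℝ (Fin d) :=
    (ContinuousLinearMap.fst ℝ (EuclideanSpace ℝ (Fin d)) him.complement) ∘L
      him.equiv.symm.toContinuousLinearMap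
  have hloc : ∀ z ∈ δ.source, π (κ (ι z)) = δ z := fun z hz => by
    have h1 := him.writtenInCharts (show δ z ∈ (him.domChart.extend (𝓡 d)).target by
      simpa using δ.map_source hz)
    have h2 : κ (ι (δ.symm (δ z))) = him.equiv (δ z, 0) := by simpa using h1
    rw [δ.left_inv hz] at h2
    rw [h2]
    change (him.equiv.symm (him.equiv (δ z, 0))).1 = δ z
    rw [ContinuousLinearEquiv.symm_apply_apply]
  -- A local left inverse of the parametrisation: in the normal form of an immersion `ι` reads `z ↦
  -- (z, 0)`, so projecting to the first factor recovers the coordinate in `δ`, and a transition map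
  -- returns to `φ`. The chain rule then gives injectivity.
  let g : EuclideanSpace ℝ (Fin D) → EuclideanSpace ℝ (Fin d) := (φ ∘ δ.symm) ∘ (fun w => π (κ w))
  have hψ : ContDiffAt ℝ ∞ (chartParam ι x) u := contDiffAt_comp_chart_symm hι.contMDiff x hu
  have hg : DifferentiableAt ℝ g (chartParam ι x u) := by
    have hψu : chartParam ι x u = ι y := rfl
    have h1 : ContDiffAt ℝ ∞ κ (ι y) := by
      rw [← contMDiffAt_iff_contDiffAt]
      exact (contMDiffOn_of_mem_maximalAtlas him.codChart_mem_maximalAtlas).contMDiffAt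
        (κ.open_source.mem_nhds hyκ)
    have h2 : DifferentiableAt ℝ (fun w => π (κ w)) (ι y) :=
      π.differentiableAt.comp (ι y) (h1.differentiableAt (by simp))
    have h3 : ContDiffAt ℝ ∞ (φ ∘ δ.symm) (δ y) :=
      contDiffAt_chart_transition him.domChart_mem_maximalAtlas
        (IsManifold.chart_mem_maximalAtlas x) (δ.map_source hyδ) (by rwa [δ.left_inv hyδ])
    rw [hψu]
    refine DifferentiableAt.comp (ι y) ?_ h2
    rw [hloc y hyδ]
    exact h3.differentiableAt (by simp)
  have hid : g ∘ chartParam ι x =ᶠ[𝓝 u] id := by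
    have hnhds : φ.target ∩ φ.symm ⁻¹' δ.source ∈ 𝓝 u :=
      (φ.symm.isOpen_inter_preimage δ.open_source).mem_nhds ⟨hu, hyδ⟩
    filter_upwards [hnhds] with v hv
    change φ (δ.symm (π (κ (ι (φ.symm v))))) = v
    rw [hloc _ hv.2, δ.left_inv hv.2, φ.right_inv hv.1]
  have hcomp := fderiv_comp u hg (hψ.differentiableAt (by simp))
  rw [hid.fderiv_eq, fderiv_id] at hcomp
  intro v w hvw
  have hv := DFunLike.congr_fun hcomp v
  have hw := DFunLike.congr_fun hcomp w
  simp only [ContinuousLinearMap.comp_apply] at hv hw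
  rw [hvw, ← hw] at hv
  simpa using hv

variable [MeasurableSpace M]

lemma sqrt_det_gram_eq_normDet
    (T : EuclideanSpace ℝ (Fin d) →L[ℝ] EuclideanSpace ℝ (Fin D)) :
    Real.sqrt (Matrix.gram ℝ (fun i : Fin d => T (EuclideanSpace.basisFun (Fin d) ℝ i))).det
      = T.toLinearMap.normDet := by
  have h := LinearMap.normDet_sq_eq_det_gram T.toLinearMap (EuclideanSpace.basisFun (Fin d) ℝ)
  simp only [ContinuousLinearMap.coe_coe, RCLike.ofReal_real_eq_id, id] at h
  rw [← h, Real.sqrt_sq (LinearMap.normDet_nonneg _)]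

variable [BorelSpace M]

lemma measurableSet_chart_target_inter_preimage (x : M) {A : Set M} (hA : MeasurableSet A) :
    MeasurableSet ((chartAt (EuclideanSpace ℝ (Fin d)) x).target ∩
      (chartAt (EuclideanSpace ℝ (Fin d)) x).symm ⁻¹' A) := by
  set φ := chartAt (EuclideanSpace ℝ (Fin d)) x
  have h1 : Measurable (fun u : φ.target => φ.symm u) :=
    φ.continuousOn_symm.domRestrict.measurable
  have h2 := φ.open_target.measurableSet.subtype_image (h1 hA)
  convert h2 using 1
  ext u
  simp [and_comm]

lemma lintegral_chartVolume (ι : M → EuclideanSpace ℝ (Fin D)) (x : M) {f : M → ℝ≥0∞}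
    (hf : Measurable f) :
    ∫⁻ y, f y ∂chartVolume (d := d) ι x
      = ∫⁻ u in (chartAt (EuclideanSpace ℝ (Fin d)) x).target,
        ENNReal.ofReal (fderiv ℝ (chartParam ι x) u).toLinearMap.normDet
          * f ((chartAt (EuclideanSpace ℝ (Fin d)) x).symm u) := by
  set φ := chartAt (EuclideanSpace ℝ (Fin d)) x with hφ
  -- The directional derivatives of any map are measurable, so no regularity of `ι` enters here.
  have hdens : Measurable fun u => ENNReal.ofReal (Real.sqrt
        (Matrix.gram ℝ (fun i : Fin d =>
          fderiv ℝ (ι ∘ φ.symm) u (EuclideanSpace.basisFun (Fin d) ℝ i))).det) := by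
    simp only [Matrix.det_apply, Matrix.gram_apply]
    refine ENNReal.measurable_ofReal.comp (Real.continuous_sqrt.measurable.comp ?_)
    refine Finset.measurable_sum _ fun σ _ => Measurable.const_smul ?_ _
    exact Finset.measurable_prod _ fun i _ =>
      (measurable_fderiv_apply_const ℝ _ _).inner (measurable_fderiv_apply_const ℝ _ _)
  have hφm : AEMeasurable φ.symm (volume.restrict φ.target) :=
    φ.continuousOn_symm.aemeasurable φ.open_target.measurableSet
  have hφm' := hφm.mono_ac (withDensity_absolutelyContinuous (volume.restrict φ.target) _ :
    (volume.restrict φ.target).withDensity (fun u => ENNReal.ofReal (Real.sqrt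
        (Matrix.gram ℝ (fun i : Fin d =>
          fderiv ℝ (ι ∘ φ.symm) u (EuclideanSpace.basisFun (Fin d) ℝ i))).det)) ≪ _)
  rw [chartVolume, lintegral_map' hf.aemeasurable hφm',
    lintegral_withDensity_eq_lintegral_mul₀' hdens.aemeasurable
      (g := fun u => f (φ.symm u)) (hf.comp_aemeasurable hφm')]
  refine lintegral_congr fun u => ?_
  rw [Pi.mul_apply, sqrt_det_gram_eq_normDet]
  rfl

lemma chartVolume_apply (ι : M → EuclideanSpace ℝ (Fin D)) (x : M) {A : Set M}
    (hA : MeasurableSet A) :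
    chartVolume (d := d) ι x A
      = ∫⁻ u in (chartAt (EuclideanSpace ℝ (Fin d)) x).target ∩
          (chartAt (EuclideanSpace ℝ (Fin d)) x).symm ⁻¹' A,
        ENNReal.ofReal (fderiv ℝ (chartParam ι x) u).toLinearMap.normDet := by
  have hm := measurableSet_chart_target_inter_preimage (d := d) x hA
  have ht := (chartAt (EuclideanSpace ℝ (Fin d)) x).open_target.measurableSet
  rw [← lintegral_indicator_one hA, lintegral_chartVolume ι x (measurable_one.indicator hA),
    ← lintegral_indicator ht, ← lintegral_indicator hm]
  refine lintegral_congr fun u => ?_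
  by_cases h1 : u ∈ (chartAt (EuclideanSpace ℝ (Fin d)) x).target <;>
    by_cases h2 : (chartAt (EuclideanSpace ℝ (Fin d)) x).symm u ∈ A <;>
      simp [Set.indicator, h1, h2]

/-- The volume elements of two charts agree on the overlap. -/
lemma chartVolume_eq_on_overlap [IsManifold (𝓡 d) ∞ M] {ι : M → EuclideanSpace ℝ (Fin D)}
    (hι : ContMDiff (𝓡 d) (𝓡 D) ∞ ι) (x x' : M) {A : Set M} (hA : MeasurableSet A)
    (h : A ⊆ (chartAt (EuclideanSpace ℝ (Fin d)) x).source)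
    (h' : A ⊆ (chartAt (EuclideanSpace ℝ (Fin d)) x').source) :
    chartVolume (d := d) ι x A = chartVolume (d := d) ι x' A := by
  rw [chartVolume_apply ι x hA, chartVolume_apply ι x' hA]
  have hS := measurableSet_chart_target_inter_preimage (d := d) x hA
  set φ := chartAt (EuclideanSpace ℝ (Fin d)) x with hφ
  set φ' := chartAt (EuclideanSpace ℝ (Fin d)) x' with hφ'
  set S := φ.target ∩ φ.symm ⁻¹' A with hSdef
  have himg : φ'.target ∩ φ'.symm ⁻¹' A = (φ' ∘ φ.symm) '' S := by
    ext v
    constructor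
    · rintro ⟨hv, hvA⟩
      refine ⟨φ (φ'.symm v), ⟨φ.map_source (h hvA), ?_⟩, ?_⟩
      · change φ.symm (φ (φ'.symm v)) ∈ A
        rwa [φ.left_inv (h hvA)]
      · change φ' (φ.symm (φ (φ'.symm v))) = v
        rw [φ.left_inv (h hvA), φ'.right_inv hv]
    · rintro ⟨u, ⟨hu, huA⟩, rfl⟩
      refine ⟨φ'.map_source (h' huA), ?_⟩
      change φ'.symm (φ' (φ.symm u)) ∈ A
      rwa [φ'.left_inv (h' huA)]
  have hτ : ∀ u ∈ S, DifferentiableAt ℝ (φ' ∘ φ.symm) u := fun u hu =>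
    (contDiffAt_chart_transition (IsManifold.chart_mem_maximalAtlas x)
      (IsManifold.chart_mem_maximalAtlas x') hu.1 (h' hu.2)).differentiableAt (by simp)
  have hinj : Set.InjOn (φ' ∘ φ.symm) S := fun u hu v hv huv => by
    have h1 : φ.symm u = φ.symm v := φ'.injOn (h' hu.2) (h' hv.2) huv
    exact φ.symm.injOn hu.1 hv.1 h1
  rw [himg, lintegral_image_eq_lintegral_abs_det_fderiv_mul volume hS
    (fun u hu => (hτ u hu).hasFDerivAt.hasFDerivWithinAt) hinj]
  refine setLIntegral_congr_fun hS fun u hu => ?_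
  have hψ' : DifferentiableAt ℝ (chartParam ι x') ((φ' ∘ φ.symm) u) :=
    (contDiffAt_comp_chart_symm hι x' (φ'.map_source (h' hu.2))).differentiableAt (by simp)
  have heq : chartParam ι x =ᶠ[𝓝 u] chartParam ι x' ∘ (φ' ∘ φ.symm) := by
    have hnhds : φ.target ∩ φ.symm ⁻¹' φ'.source ∈ 𝓝 u :=
      (φ.symm.isOpen_inter_preimage φ'.open_source).mem_nhds ⟨hu.1, h' hu.2⟩
    filter_upwards [hnhds] with v hv
    change ι (φ.symm v) = ι (φ'.symm (φ' (φ.symm v)))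
    rw [φ'.left_inv hv.2]
  have hcomp : fderiv ℝ (chartParam ι x) u
      = fderiv ℝ (chartParam ι x') ((φ' ∘ φ.symm) u) ∘L fderiv ℝ (φ' ∘ φ.symm) u := by
    rw [heq.fderiv_eq, fderiv_comp u hψ' (hτ u hu)]
  -- The Jacobian of the composite splits off the determinant of the transition map, which is
  -- exactly the factor produced by the change of variables.
  rw [hcomp, ContinuousLinearMap.toLinearMap_comp, LinearMap.normDet_comp_of_finrank_eq _ _ rfl,
    LinearMap.normDet_eq_abs_det, mul_comm, ENNReal.ofReal_mul (abs_nonneg _)]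

/-- On the domain of a chart the Riemannian volume is the volume of that chart. -/
lemma riemannianVolume_apply [IsManifold (𝓡 d) ∞ M] {ι : M → EuclideanSpace ℝ (Fin D)}
    (hι : ContMDiff (𝓡 d) (𝓡 D) ∞ ι) (x : M) {A : Set M} (hA : MeasurableSet A)
    (h : A ⊆ (chartAt (EuclideanSpace ℝ (Fin d)) x).source) :
    riemannianVolume (d := d) ι A = chartVolume (d := d) ι x A := by
  refine le_antisymm ?_ (Measure.le_iff.1 (le_iSup (chartVolume (d := d) ι) x) A hA)
  set V := (chartAt (EuclideanSpace ℝ (Fin d)) x).source with hV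
  have hVm : MeasurableSet V := (chartAt (EuclideanSpace ℝ (Fin d)) x).open_source.measurableSet
  have hsrc : ∀ z : M, chartVolume (d := d) ι z
      (chartAt (EuclideanSpace ℝ (Fin d)) z).sourceᶜ = 0 := fun z => by
    have hm : MeasurableSet (chartAt (EuclideanSpace ℝ (Fin d)) z).sourceᶜ :=
      (chartAt (EuclideanSpace ℝ (Fin d)) z).open_source.measurableSet.compl
    rw [chartVolume_apply ι z hm]
    convert setLIntegral_empty _
    ext u
    simp only [Set.mem_inter_iff, Set.mem_preimage, Set.mem_compl_iff, Set.mem_empty_iff_false,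
      iff_false, not_and, not_not]
    exact fun hu => (chartAt (EuclideanSpace ℝ (Fin d)) z).map_target hu
  -- The right-hand side dominates every chart volume: inside `V` by agreement on overlaps, outside
  -- `V` by the definition of the supremum. Hence it dominates the supremum, and its second term
  -- ignores `A`.
  have hle : riemannianVolume (d := d) ι
      ≤ chartVolume (d := d) ι x + (riemannianVolume (d := d) ι).restrict Vᶜ := by
    refine iSup_le fun z => Measure.le_iff.2 fun B hB => ?_
    rw [Measure.add_apply, Measure.restrict_apply hB, ← measure_inter_add_sdiff B hVm]
    refine add_le_add ?_ ?_
    · set W := (chartAt (EuclideanSpace ℝ (Fin d)) z).source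
      have hWm : MeasurableSet W :=
        (chartAt (EuclideanSpace ℝ (Fin d)) z).open_source.measurableSet
      calc chartVolume (d := d) ι z (B ∩ V)
          ≤ chartVolume (d := d) ι z (B ∩ V ∩ W) + chartVolume (d := d) ι z Wᶜ := by
            refine (measure_mono fun b hb => ?_).trans (measure_union_le _ _)
            by_cases hW : b ∈ W
            · exact Or.inl ⟨hb, hW⟩
            · exact Or.inr hW
        _ = chartVolume (d := d) ι x (B ∩ V ∩ W) := by
            rw [hsrc, add_zero]
            exact chartVolume_eq_on_overlap hι z x ((hB.inter hVm).inter hWm)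
              Set.inter_subset_right (fun b hb => hb.1.2)
        _ ≤ chartVolume (d := d) ι x B := measure_mono fun b hb => hb.1.1
    · exact Measure.le_iff.1 (le_iSup (chartVolume (d := d) ι) z) _ (hB.diff hVm)
  have h1 := Measure.le_iff.1 hle A hA
  rwa [Measure.add_apply, Measure.restrict_apply hA, (by
    ext a; simpa using fun ha => h ha : A ∩ Vᶜ = ∅), measure_empty, add_zero] at h1

end Charts

/-! ### Mass of extrinsic balls on the manifold -/

section BallMass

variable {d D : ℕ} {M : Type*} [TopologicalSpace M] [ChartedSpace (EuclideanSpace ℝ (Fin d)) M]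

/-- The points of `M` at Euclidean distance less than `r` from `ι x`. -/
def extrinsicBall (ι : M → EuclideanSpace ℝ (Fin D)) (x : M) (r : ℝ) : Set M :=
  {y | ‖ι y - ι x‖ < r}

variable [MeasurableSpace M] [BorelSpace M]

omit [ChartedSpace (EuclideanSpace ℝ (Fin d)) M] in
lemma measurableSet_extrinsicBall {ι : M → EuclideanSpace ℝ (Fin D)} (hι : Continuous ι) (x : M)
    (r : ℝ) : MeasurableSet (extrinsicBall ι x r) :=
  (isOpen_lt (hι.sub continuous_const).norm continuous_const).measurableSet

lemma samplingLaw_apply [IsManifold (𝓡 d) ∞ M] {ι : M → EuclideanSpace ℝ (Fin D)}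
    (hι : ContMDiff (𝓡 d) (𝓡 D) ∞ ι) {p : M → ℝ} (hp : Continuous p) (x : M) {A : Set M}
    (hA : MeasurableSet A) (h : A ⊆ (chartAt (EuclideanSpace ℝ (Fin d)) x).source) :
    samplingLaw (d := d) ι p A
      = ∫⁻ u in (chartAt (EuclideanSpace ℝ (Fin d)) x).target ∩
          (chartAt (EuclideanSpace ℝ (Fin d)) x).symm ⁻¹' A,
        ENNReal.ofReal (fderiv ℝ (chartParam ι x) u).toLinearMap.normDet
          * ENNReal.ofReal (p ((chartAt (EuclideanSpace ℝ (Fin d)) x).symm u)) := by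
  have hm := measurableSet_chart_target_inter_preimage (d := d) x hA
  have ht := (chartAt (EuclideanSpace ℝ (Fin d)) x).open_target.measurableSet
  have hpm : Measurable fun x => ENNReal.ofReal (p x) :=
    ENNReal.measurable_ofReal.comp hp.measurable
  have hres : (riemannianVolume (d := d) ι).restrict A
      = (chartVolume (d := d) ι x).restrict A := by
    refine Measure.ext fun B hB => ?_
    rw [Measure.restrict_apply hB, Measure.restrict_apply hB]
    exact riemannianVolume_apply hι x (hB.inter hA) (Set.inter_subset_right.trans h)
  rw [samplingLaw, withDensity_apply _ hA, hres, ← lintegral_indicator hA,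
    lintegral_chartVolume ι x (hpm.indicator hA), ← lintegral_indicator ht, ← lintegral_indicator hm]
  refine lintegral_congr fun u => ?_
  by_cases h1 : u ∈ (chartAt (EuclideanSpace ℝ (Fin d)) x).target <;>
    by_cases h2 : (chartAt (EuclideanSpace ℝ (Fin d)) x).symm u ∈ A <;>
      simp [Set.indicator, h1, h2]

/-- The mass of the extrinsic balls around the points of `s`, and the oscillation of `p` there. -/
def HasBallExpansionOn (d : ℕ) {D : ℕ} {M : Type*} [TopologicalSpace M]
    [ChartedSpace (EuclideanSpace ℝ (Fin d)) M] [MeasurableSpace M]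
    (ι : M → EuclideanSpace ℝ (Fin D)) (p : M → ℝ) (s : Set M) (L C r₁ : ℝ) : Prop :=
  ∀ x ∈ s, (∀ r, 0 < r → r < r₁ →
      samplingLaw (d := d) ι p (extrinsicBall ι x r)
        ≤ ENNReal.ofReal (volume.real (Metric.ball (0 : EuclideanSpace ℝ (Fin d)) 1) * p x
            * r ^ d * (1 + C * r ^ 2)) ∧
      ENNReal.ofReal (volume.real (Metric.ball (0 : EuclideanSpace ℝ (Fin d)) 1) * p x
            * r ^ d * (1 - C * r ^ 2))
        ≤ samplingLaw (d := d) ι p (extrinsicBall ι x r)) ∧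
    ∀ y ∈ extrinsicBall ι x r₁, |p y - p x| ≤ L * ‖ι y - ι x‖

omit [BorelSpace M] in
lemma HasBallExpansionOn.mono {ι : M → EuclideanSpace ℝ (Fin D)} {p : M → ℝ} {s t : Set M}
    {L C r₁ L' C' r₁' : ℝ} (h : HasBallExpansionOn d ι p s L C r₁) (hp : ∀ x, 0 ≤ p x)
    (hts : t ⊆ s) (hL : L ≤ L') (hC : C ≤ C') (hr : r₁' ≤ r₁) :
    HasBallExpansionOn d ι p t L' C' r₁' := fun x hx => by
  obtain ⟨h1, h2⟩ := h x (hts hx)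
  have hpx := hp x
  refine ⟨fun r h0 hr1 => ?_, fun y hy => ?_⟩
  · obtain ⟨hu, hl⟩ := h1 r h0 (hr1.trans_le hr)
    refine ⟨hu.trans (ENNReal.ofReal_le_ofReal ?_), le_trans (ENNReal.ofReal_le_ofReal ?_) hl⟩ <;>
      gcongr
  · exact (h2 y (lt_of_lt_of_le hy hr)).trans (by gcongr)

/-- The topology of `M` is induced by `ι`, so a small extrinsic ball lies entirely in one chart
patch: no distant sheet of `M` comes back close to `ι x₀`. The expansion in the patch is therefore
the expansion of the whole ball. -/
lemma exists_hasBallExpansionOn_nhds [IsManifold (𝓡 d) ∞ M] {ι : M → EuclideanSpace ℝ (Fin D)}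
    (hι : Manifold.IsSmoothEmbedding (𝓡 d) (𝓡 D) ∞ ι) {p : M → ℝ}
    (hp : ContMDiff (𝓡 d) 𝓘(ℝ, ℝ) ∞ p) (hpos : ∀ x, 0 < p x) (x₀ : M) :
    ∃ s ∈ 𝓝 x₀, ∃ L C r₁ : ℝ, 0 ≤ L ∧ 0 ≤ C ∧ 0 < r₁ ∧ HasBallExpansionOn d ι p s L C r₁ := by
  set φ := chartAt (EuclideanSpace ℝ (Fin d)) x₀ with hφ
  have hx₀ : x₀ ∈ φ.source := mem_chart_source _ x₀
  have hu₀ : φ x₀ ∈ φ.target := φ.map_source hx₀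
  have hψ := contDiffAt_comp_chart_symm hι.contMDiff x₀ hu₀
  have hq := contDiffAt_comp_chart_symm hp x₀ hu₀
  obtain ⟨η, L, C, r₁, hη, hL, hC, hr₁, hsub, hexp⟩ :=
    exists_local_volume_expansion (ψ := chartParam ι x₀) (q := p ∘ φ.symm) (u₀ := φ x₀)
      (hψ.of_le (WithTop.coe_le_coe.2 (le_top : (2 : ℕ∞) ≤ ⊤))) (injective_fderiv_chartParam hι x₀ hu₀)
      (hq.of_le (WithTop.coe_le_coe.2 (le_top : (2 : ℕ∞) ≤ ⊤))) (hpos _) (φ.open_target.mem_nhds hu₀)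
  have hV : φ.source ∩ φ ⁻¹' Metric.ball (φ x₀) (η / 2) ∈ 𝓝 x₀ :=
    (φ.isOpen_inter_preimage Metric.isOpen_ball).mem_nhds
      ⟨hx₀, Metric.mem_ball_self (by positivity)⟩
  rw [hι.isEmbedding.isInducing.nhds_eq_comap, mem_comap] at hV
  obtain ⟨T, hT, hTV⟩ := hV
  obtain ⟨δ, hδ, hball⟩ := Metric.mem_nhds_iff.1 hT
  have hnear : ∀ y, ‖ι y - ι x₀‖ < δ → y ∈ φ.source ∧ φ y ∈ Metric.ball (φ x₀) (η / 2) :=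
    fun y hy => hTV (hball (by simpa [dist_eq_norm] using hy))
  refine ⟨extrinsicBall ι x₀ (δ / 2), ?_, L, C, min r₁ (δ / 2), hL, hC, by positivity,
    fun x hx => ?_⟩
  · exact (isOpen_lt (hι.isEmbedding.continuous.sub continuous_const).norm
      continuous_const).mem_nhds (by simpa using hδ)
  have hx' : ‖ι x - ι x₀‖ < δ / 2 := hx
  have hclose : ∀ y, ‖ι y - ι x‖ < δ / 2 → y ∈ φ.source ∧ φ y ∈ Metric.ball (φ x₀) (η / 2) :=
    fun y hy => hnear y (by
      have := norm_add_le (ι y - ι x) (ι x - ι x₀)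
      rw [sub_add_sub_cancel] at this
      linarith)
  have hxs := hclose x (by simpa using hδ)
  have hparam : ∀ y ∈ φ.source, chartParam ι x₀ (φ y) = ι y := fun y hy => by
    change ι (φ.symm (φ y)) = ι y
    rw [φ.left_inv hy]
  have hpx : (p ∘ φ.symm) (φ x) = p x := congrArg p (φ.left_inv hxs.1)
  obtain ⟨h1, h2⟩ := hexp (φ x) hxs.2
  rw [hpx] at h2
  constructor
  · intro r h0 hr
    have hset : φ.target ∩ φ.symm ⁻¹' extrinsicBall ι x r
        = {v | v ∈ Metric.ball (φ x₀) η ∧ ‖chartParam ι x₀ v - chartParam ι x₀ (φ x)‖ < r} := by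
      ext v
      rw [hparam x hxs.1]
      constructor
      · rintro ⟨hv, hvr⟩
        have hvr' : ‖ι (φ.symm v) - ι x‖ < r := hvr
        have := (hclose (φ.symm v) (hvr'.trans (hr.trans_le (min_le_right _ _)))).2
        rw [φ.right_inv hv] at this
        exact ⟨Metric.ball_subset_ball (by linarith) this, hvr⟩
      · rintro ⟨hv, hvr⟩
        exact ⟨hsub hv, hvr⟩
    have h3 := h1 r h0 (hr.trans_le (min_le_left _ _))
    rw [samplingLaw_apply hι.contMDiff hp.continuous x₀
      (measurableSet_extrinsicBall hι.isEmbedding.continuous x r)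
      (fun y hy => (hclose y (lt_trans hy (hr.trans_le (min_le_right _ _)))).1), hset]
    simp only [hpx, finrank_euclideanSpace_fin] at h3
    exact h3
  · intro y hy
    have hys := hclose y (lt_of_lt_of_le hy (min_le_right _ _))
    have h3 := h2 (φ y) (Metric.ball_subset_ball (by linarith) hys.2)
    have hpy : (p ∘ φ.symm) (φ y) = p y := congrArg p (φ.left_inv hys.1)
    rwa [hparam x hxs.1, hparam y hys.1, hpy] at h3

/-- Uniform second-order expansion of the mass of small extrinsic balls on a compact manifold. -/
theorem exists_hasBallExpansionOn_univ [IsManifold (𝓡 d) ∞ M] [CompactSpace M]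
    {ι : M → EuclideanSpace ℝ (Fin D)}
    (hι : Manifold.IsSmoothEmbedding (𝓡 d) (𝓡 D) ∞ ι) {p : M → ℝ}
    (hp : ContMDiff (𝓡 d) 𝓘(ℝ, ℝ) ∞ p) (hpos : ∀ x, 0 < p x) :
    ∃ L C r₁ : ℝ, 0 ≤ L ∧ 0 ≤ C ∧ 0 < r₁ ∧ HasBallExpansionOn d ι p Set.univ L C r₁ := by
  have hp0 : ∀ x, 0 ≤ p x := fun x => (hpos x).le
  refine isCompact_univ.induction_on
    (p := fun s => ∃ L C r₁ : ℝ, 0 ≤ L ∧ 0 ≤ C ∧ 0 < r₁ ∧ HasBallExpansionOn d ι p s L C r₁)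
    ⟨0, 0, 1, le_rfl, le_rfl, one_pos, fun x hx => hx.elim⟩ ?_ ?_ ?_
  · rintro s t hst ⟨L, C, r₁, hL, hC, hr, h⟩
    exact ⟨L, C, r₁, hL, hC, hr, h.mono hp0 hst le_rfl le_rfl le_rfl⟩
  · rintro s t ⟨L, C, r₁, hL, hC, hr, h⟩ ⟨L', C', r₁', hL', hC', hr', h'⟩
    refine ⟨max L L', max C C', min r₁ r₁', le_max_of_le_left hL, le_max_of_le_left hC,
      lt_min hr hr', fun x hx => ?_⟩
    rcases hx with hx | hx
    · exact h.mono hp0 le_rfl (le_max_left _ _) (le_max_left _ _) (min_le_left _ _) x hx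
    · exact h'.mono hp0 le_rfl (le_max_right _ _) (le_max_right _ _) (min_le_right _ _) x hx
  · intro x _
    obtain ⟨s, hs, h⟩ := exists_hasBallExpansionOn_nhds hι hp hpos x
    exact ⟨s, mem_nhdsWithin_of_mem_nhds hs, h⟩

end BallMass

/-! ### Chernoff bounds for sample counts -/

section BinomialTails

variable {X : Type*} [MeasurableSpace X]

/-- The number of sample points in `A`. -/
def sampleCount {N : ℕ} (A : Set X) (Y : Fin N → X) : ℝ :=
  ∑ j, A.indicator 1 (Y j)

lemma measurable_sampleCount {N : ℕ} {A : Set X} (hA : MeasurableSet A) :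
    Measurable (sampleCount (N := N) A) :=
  Finset.measurable_sum _ fun j _ => (measurable_one.indicator hA).comp (measurable_pi_apply j)

omit [MeasurableSpace X] in
lemma sampleCount_mem_Icc {N : ℕ} (A : Set X) (Y : Fin N → X) :
    sampleCount A Y ∈ Set.Icc 0 (N : ℝ) := by
  constructor
  · exact Finset.sum_nonneg fun j _ => Set.indicator_nonneg (fun _ _ => zero_le_one) _
  · calc sampleCount A Y ≤ ∑ _j : Fin N, (1 : ℝ) :=
          Finset.sum_le_sum fun j _ => Set.indicator_le_self' (fun _ _ => zero_le_one) _
      _ = N := by simp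

omit [MeasurableSpace X] in
lemma sampleCount_eq_card {N : ℕ} (A : Set X) (Y : Fin N → X) [DecidablePred fun j => Y j ∈ A] :
    sampleCount A Y = ((Finset.univ.filter fun j => Y j ∈ A).card : ℝ) := by
  classical
  simp [sampleCount, Set.indicator, Finset.sum_boole]

variable (ν : Measure X) [IsProbabilityMeasure ν]

lemma integrable_exp_mul_sampleCount (N : ℕ) {A : Set X} (hA : MeasurableSet A) (t : ℝ) :
    Integrable (fun Y : Fin N → X => Real.exp (t * sampleCount A Y))
      (Measure.pi fun _ : Fin N => ν) := by
  refine Integrable.of_bound (C := Real.exp (|t| * N))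
    (Real.measurable_exp.comp ((measurable_sampleCount hA).const_mul t)).aestronglyMeasurable
    (ae_of_all _ fun Y => ?_)
  obtain ⟨h0, h1⟩ := sampleCount_mem_Icc A Y
  rw [Real.norm_eq_abs, Real.abs_exp]
  refine Real.exp_le_exp.2 ?_
  calc t * sampleCount A Y ≤ |t| * sampleCount A Y := by gcongr; exact le_abs_self t
    _ ≤ |t| * N := by gcongr

/-- Independence factors the moment generating function into `N` equal Bernoulli ones, and `1 + x ≤
eˣ` replaces each by its Poisson analogue. -/
lemma mgf_sampleCount_le (N : ℕ) {A : Set X} (hA : MeasurableSet A) (t : ℝ) :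
    ProbabilityTheory.mgf (sampleCount A) (Measure.pi fun _ : Fin N => ν) t
      ≤ Real.exp (N * ν.real A * (Real.exp t - 1)) := by
  have h1 : ∀ Y : Fin N → X, Real.exp (t * sampleCount A Y)
      = ∏ j, (1 + A.indicator (fun _ => Real.exp t - 1) (Y j)) := fun Y => by
    rw [sampleCount, Finset.mul_sum, Real.exp_sum]
    refine Finset.prod_congr rfl fun j _ => ?_
    by_cases h : Y j ∈ A <;> simp [h]
  have h2 : ∫ x, (1 + A.indicator (fun _ => Real.exp t - 1) x) ∂ν
      = 1 + ν.real A * (Real.exp t - 1) := by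
    rw [integral_add (integrable_const _) ((integrable_const _).indicator hA),
      integral_indicator_const _ hA]
    simp
  rw [ProbabilityTheory.mgf]
  simp_rw [h1]
  rw [integral_fintype_prod_eq_prod
    (f := fun _ : Fin N => fun x => 1 + A.indicator (fun _ => Real.exp t - 1) x)]
  simp only [h2, Finset.prod_const, Finset.card_univ, Fintype.card_fin]
  have h3 : 0 ≤ 1 + ν.real A * (Real.exp t - 1) := by
    have := measureReal_le_one (μ := ν) (s := A)
    have := measureReal_nonneg (μ := ν) (s := A)
    nlinarith [Real.exp_pos t]
  calc (1 + ν.real A * (Real.exp t - 1)) ^ N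
      ≤ (Real.exp (ν.real A * (Real.exp t - 1))) ^ N := by
        gcongr
        linarith [Real.add_one_le_exp (ν.real A * (Real.exp t - 1))]
    _ = _ := by rw [← Real.exp_nat_mul]; ring_nf

/-- Chernoff bound for too many points in a set of small expected count. -/
lemma measureReal_le_sampleCount_le (N : ℕ) {A : Set X} (hA : MeasurableSet A) {k δ : ℝ}
    (hk : 0 ≤ k) (hδ0 : 0 ≤ δ) (hδ1 : δ ≤ 1) (hm : N * ν.real A ≤ k * (1 - δ)) :
    (Measure.pi fun _ : Fin N => ν).real {Y | k ≤ sampleCount A Y}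
      ≤ Real.exp (-(k * δ ^ 2 / 4)) := by
  -- With `eᵗ - 1 ≤ t + t²` the exponent is at most `k (-δ t + (1 - δ) t²)`, whose minimiser is `δ /
  -- 2` to leading order.
  refine (ProbabilityTheory.measure_ge_le_exp_mul_mgf k (by positivity : 0 ≤ δ / 2)
    (integrable_exp_mul_sampleCount ν N hA _)).trans ?_
  refine (mul_le_mul_of_nonneg_left (mgf_sampleCount_le ν N hA _) (Real.exp_pos _).le).trans ?_
  rw [← Real.exp_add]
  refine Real.exp_le_exp.2 ?_
  have h1 := (abs_le.1 (Real.abs_exp_sub_one_sub_id_le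
    (by rw [abs_of_nonneg (by positivity)]; linarith : |δ / 2| ≤ 1))).2
  have h2 : Real.exp (δ / 2) - 1 ≤ δ / 2 + (δ / 2) ^ 2 := by linarith
  have h3 : 0 ≤ Real.exp (δ / 2) - 1 := by linarith [Real.one_le_exp (by positivity : 0 ≤ δ / 2)]
  have h4 : N * ν.real A * (Real.exp (δ / 2) - 1) ≤ k * (1 - δ) * (δ / 2 + (δ / 2) ^ 2) :=
    mul_le_mul hm h2 h3 (mul_nonneg hk (by linarith))
  have h5 : 0 ≤ k * δ ^ 3 := by positivity
  nlinarith

/-- Chernoff bound for too few points in a set of large expected count. -/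
lemma measureReal_sampleCount_le_le (N : ℕ) {A : Set X} (hA : MeasurableSet A) {k δ : ℝ}
    (hδ0 : 0 ≤ δ) (hδ1 : δ ≤ 1) (hm : k * (1 + δ) ≤ N * ν.real A) :
    (Measure.pi fun _ : Fin N => ν).real {Y | sampleCount A Y ≤ k}
      ≤ Real.exp (-(k * δ ^ 2 / 4 * (1 - δ))) := by
  -- The mirrored choice of parameter. Here the cubic term has the unfavourable sign, which leaves
  -- the factor `1 - δ` in the exponent.
  refine (ProbabilityTheory.measure_le_le_exp_mul_mgf k (by linarith : -(δ / 2) ≤ 0)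
    (integrable_exp_mul_sampleCount ν N hA _)).trans ?_
  refine (mul_le_mul_of_nonneg_left (mgf_sampleCount_le ν N hA _) (Real.exp_pos _).le).trans ?_
  rw [← Real.exp_add]
  refine Real.exp_le_exp.2 ?_
  have h1 := (abs_le.1 (Real.abs_exp_sub_one_sub_id_le
    (by rw [abs_neg, abs_of_nonneg (by positivity)]; linarith : |-(δ / 2)| ≤ 1))).2
  have h2 : Real.exp (-(δ / 2)) - 1 ≤ -(δ / 2 - (δ / 2) ^ 2) := by linarith
  have h3 : 0 ≤ δ / 2 - (δ / 2) ^ 2 := by nlinarith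
  have h4 : N * ν.real A * (Real.exp (-(δ / 2)) - 1) ≤ -(k * (1 + δ) * (δ / 2 - (δ / 2) ^ 2)) := by
    have h5 : k * (1 + δ) * (δ / 2 - (δ / 2) ^ 2) ≤ N * ν.real A * (δ / 2 - (δ / 2) ^ 2) := by
      gcongr
    have h6 : 0 ≤ N * ν.real A := by positivity
    nlinarith
  nlinarith

end BinomialTails

/-! ### From counts to nearest-neighbour radii, and nets -/

section NearestNeighbours

variable {d D : ℕ} {M : Type*} {ι : M → EuclideanSpace ℝ (Fin D)}

lemma m0_indicator_Ico (d : ℕ) :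
    m0 d (Set.indicator (Set.Ico 0 1) 1)
      = volume.real (Metric.ball (0 : EuclideanSpace ℝ (Fin d)) 1) := by
  rw [m0, ← integral_indicator_one measurableSet_ball]
  refine integral_congr_ae (ae_of_all _ fun u => ?_)
  have h : ‖u‖ ^ 2 ∈ Set.Ico (0 : ℝ) 1 ↔ u ∈ Metric.ball (0 : EuclideanSpace ℝ (Fin d)) 1 := by
    rw [mem_ball_zero_iff, Set.mem_Ico, sq_lt_one_iff₀ (norm_nonneg u)]
    exact ⟨fun h => h.2, fun h => ⟨by positivity, h⟩⟩
  by_cases hu : u ∈ Metric.ball (0 : EuclideanSpace ℝ (Fin d)) 1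
  · simp only [Set.indicator_of_mem hu, Set.indicator_of_mem (h.2 hu), Pi.one_apply]
  · simp only [Set.indicator_of_notMem hu, Set.indicator_of_notMem (fun h' => hu (h.1 h'))]

lemma extrinsicBall_subset {x x' : M} {r ε : ℝ} (h : ‖ι x - ι x'‖ ≤ ε) :
    extrinsicBall ι x r ⊆ extrinsicBall ι x' (r + ε) := fun y hy => by
  have hy' : ‖ι y - ι x‖ < r := hy
  have := norm_add_le (ι y - ι x) (ι x - ι x')
  rw [sub_add_sub_cancel] at this
  change ‖ι y - ι x'‖ < r + ε
  linarith

lemma sampleCount_mono {N : ℕ} {A B : Set M} (h : A ⊆ B) (Y : Fin N → M) :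
    sampleCount A Y ≤ sampleCount B Y :=
  Finset.sum_le_sum fun _ _ => Set.indicator_le_indicator_of_subset h (fun _ => zero_le_one) _

lemma sampleCount_extrinsicBall {N : ℕ} (Y : Fin N → M) (x : M) (r : ℝ) :
    sampleCount (extrinsicBall ι x r) Y
      = ((Finset.univ.filter fun j : Fin N => ‖ι (Y j) - ι x‖ < r).card : ℝ) := by
  classical
  rw [sampleCount_eq_card]
  congr

lemma knnRadius_le {N k : ℕ} {Y : Fin N → M} {x : M} {r : ℝ} (hr : 0 < r)
    (h : (k : ℝ) ≤ sampleCount (extrinsicBall ι x r) Y) :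
    knnRadius k (fun j => ι (Y j)) (ι x) ≤ r := by
  refine csInf_le ⟨0, fun s hs => hs.1.le⟩ ⟨hr, ?_⟩
  rw [sampleCount_extrinsicBall] at h
  exact_mod_cast h

/-- The radius `r'` only witnesses that the set of admissible radii is nonempty; otherwise its real
infimum would be the default value `0`. -/
lemma le_knnRadius {N k : ℕ} {Y : Fin N → M} {x : M} {r r' : ℝ} (hr' : 0 < r')
    (h' : (k : ℝ) ≤ sampleCount (extrinsicBall ι x r') Y)
    (h : sampleCount (extrinsicBall ι x r) Y < k) :
    r ≤ knnRadius k (fun j => ι (Y j)) (ι x) := by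
  rw [sampleCount_extrinsicBall] at h'
  refine le_csInf ⟨r', hr', by exact_mod_cast h'⟩ fun s hs => ?_
  by_contra hsr
  have h1 : (k : ℝ) ≤ sampleCount (extrinsicBall ι x s) Y := by
    rw [sampleCount_extrinsicBall]
    exact_mod_cast hs.2
  have hsub : extrinsicBall ι x s ⊆ extrinsicBall ι x r := fun y hy =>
    lt_trans (show ‖ι y - ι x‖ < s from hy) (not_le.1 hsr)
  linarith [sampleCount_mono hsub Y]

/-- If all balls of radius `ε / 2` have mass at least `c`, there is an `ε`-net with at most `1 / c`
points. -/
lemma exists_finset_net [TopologicalSpace M] [MeasurableSpace M] [BorelSpace M] (hι : Continuous ι)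
    (ν : Measure M)
    [IsProbabilityMeasure ν] {ε c : ℝ} (hc : 0 < c)
    (h : ∀ x, c ≤ ν.real (extrinsicBall ι x (ε / 2))) :
    ∃ T : Finset M, c * T.card ≤ 1 ∧ ∀ x, ∃ x' ∈ T, ‖ι x - ι x'‖ < ε := by
  classical
  let sep : Finset M → Prop := fun T => ∀ x ∈ T, ∀ y ∈ T, x ≠ y → ε ≤ ‖ι x - ι y‖
  have hcard : ∀ T, sep T → c * T.card ≤ 1 := fun T hT => by
    have hdisj : (T : Set M).PairwiseDisjoint fun x => extrinsicBall ι x (ε / 2) := by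
      intro x hx y hy hxy
      refine Set.disjoint_left.2 fun z hz1 hz2 => ?_
      have h1 : ‖ι z - ι x‖ < ε / 2 := hz1
      have h2 : ‖ι z - ι y‖ < ε / 2 := hz2
      have h3 := hT x hx y hy hxy
      have h4 := norm_sub_le (ι z - ι y) (ι z - ι x)
      rw [sub_sub_sub_cancel_left] at h4
      linarith
    have h1 := measureReal_biUnion_finset (μ := ν) hdisj
      (fun x _ => measurableSet_extrinsicBall hι x _)
    have h2 : ∑ _x ∈ T, c ≤ ∑ x ∈ T, ν.real (extrinsicBall ι x (ε / 2)) :=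
      Finset.sum_le_sum fun x _ => h x
    rw [← h1, Finset.sum_const, nsmul_eq_mul] at h2
    have h3 : ν.real (⋃ x ∈ T, extrinsicBall ι x (ε / 2)) ≤ 1 := measureReal_le_one
    linarith
  let S : Set ℕ := {n | ∃ T, sep T ∧ T.card = n}
  have hne : S.Nonempty := ⟨0, ∅, fun x hx => absurd hx (Finset.notMem_empty x), rfl⟩
  have hbdd : BddAbove S := by
    refine ⟨⌊c⁻¹⌋₊, ?_⟩
    rintro n ⟨T, hT, rfl⟩
    refine Nat.le_floor ?_
    have := hcard T hT
    rw [← one_div, le_div_iff₀ hc]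
    linarith
  -- An `ε`-separated set of largest cardinality. Its half-radius balls are disjoint, which bounds
  -- its size, and maximality makes it a net. If `x ∈ T` violated the net property then `ε ≤ 0`, and
  -- an empty ball would have positive mass.
  obtain ⟨T, hT, hTcard⟩ := Nat.sSup_mem hne hbdd
  refine ⟨T, hcard T hT, fun x => ?_⟩
  by_contra! hx
  by_cases hxT : x ∈ T
  · have h1 := hx x hxT
    rw [sub_self, norm_zero] at h1
    have h2 : extrinsicBall ι x (ε / 2) = ∅ := by
      refine Set.eq_empty_of_forall_notMem fun y hy => ?_
      have h3 : ‖ι y - ι x‖ < ε / 2 := hy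
      linarith [norm_nonneg (ι y - ι x)]
    have h4 := h x
    rw [h2, measureReal_empty] at h4
    linarith
  · have h1 : sep (insert x T) := by
      intro y hy z hz hyz
      rcases Finset.mem_insert.1 hy with hyx | hyT <;> rcases Finset.mem_insert.1 hz with hzx | hzT
      · exact absurd (hyx.trans hzx.symm) hyz
      · rw [hyx]; exact hx z hzT
      · rw [hzx, norm_sub_rev]; exact hx y hyT
      · exact hT y hyT z hzT hyz
    have h2 : (insert x T).card ≤ sSup S := le_csSup hbdd ⟨_, h1, rfl⟩
    rw [Finset.card_insert_of_notMem hxT] at h2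
    omega

end NearestNeighbours

/-! ### From count deviations to relative error of the bandwidth -/

section RelativeError

/-- Chooses the radius margin `η` that absorbs both the fluctuation `δ` and the bias `b`. To first
order `dη = δ + b` would do; the factor `11 / 10` pays for the products, since `11 / 10 * (1 - x) ≥
1` exactly when `x ≤ 1 / 11`. -/
lemma one_sub_pow_mul_le {d : ℕ} (hd : 1 ≤ d) {δ b η : ℝ} (hδ : 0 ≤ δ) (hδ' : δ ≤ 1 / 11)
    (hb : 0 ≤ b) (hb' : b ≤ 1 / 11) (hη : d * η = 11 / 10 * (δ + b)) :
    0 ≤ η ∧ η ≤ 1 / 5 ∧ (1 - η) ^ d * (1 + b) ≤ 1 - δ ∧ 1 + δ ≤ (1 + η) ^ d * (1 - b) := by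
  have hd' : (1 : ℝ) ≤ d := by exact_mod_cast hd
  have hη0 : 0 ≤ η := by
    by_contra hneg
    nlinarith
  have hη1 : η ≤ 1 / 5 := by nlinarith
  have hber : 1 + d * η ≤ (1 + η) ^ d := one_add_mul_le_pow (by linarith) d
  refine ⟨hη0, hη1, ?_, ?_⟩
  · have h1 : (1 - η) ^ d * (1 + d * η) ≤ 1 := by
      calc (1 - η) ^ d * (1 + d * η) ≤ (1 - η) ^ d * (1 + η) ^ d := by
            gcongr
            exact pow_nonneg (by linarith) _
        _ = (1 - η ^ 2) ^ d := by rw [← mul_pow]; ring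
        _ ≤ 1 := pow_le_one₀ (by nlinarith) (by nlinarith)
    have h2 : 1 + b ≤ (1 - δ) * (1 + d * η) := by rw [hη]; nlinarith
    have h3 : 0 ≤ (1 - η) ^ d := pow_nonneg (by linarith) _
    calc (1 - η) ^ d * (1 + b) ≤ (1 - η) ^ d * ((1 - δ) * (1 + d * η)) := by gcongr
      _ = (1 - δ) * ((1 - η) ^ d * (1 + d * η)) := by ring
      _ ≤ (1 - δ) * 1 := by gcongr; linarith
      _ = 1 - δ := mul_one _
  · calc 1 + δ ≤ (1 + d * η) * (1 - b) := by rw [hη]; nlinarith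
      _ ≤ (1 + η) ^ d * (1 - b) := by gcongr; linarith

lemma rpow_neg_one_div_pow {d : ℕ} (hd : 1 ≤ d) {P : ℝ} (hP : 0 ≤ P) :
    (P ^ (-1 / (d : ℝ))) ^ d = P⁻¹ := by
  have hd' : (d : ℝ) ≠ 0 := by positivity
  rw [← Real.rpow_natCast, ← Real.rpow_mul hP, div_mul_cancel₀ _ hd', Real.rpow_neg_one]

lemma rpow_neg_one_div_le_mul {d : ℕ} (hd : 1 ≤ d) {P P' s : ℝ} (hP : 0 < P) (hP' : 0 < P')
    (hs : 0 ≤ s) (h : P ≤ P' * (1 + s)) :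
    P' ^ (-1 / (d : ℝ)) ≤ P ^ (-1 / (d : ℝ)) * (1 + s) := by
  refine le_of_pow_le_pow_left₀ (n := d) (by omega) (by positivity) ?_
  rw [mul_pow, rpow_neg_one_div_pow hd hP.le, rpow_neg_one_div_pow hd hP'.le]
  have h1 : 1 + s ≤ (1 + s) ^ d := le_self_pow₀ (by linarith) (by omega)
  rw [inv_mul_eq_div, le_div_iff₀ hP, inv_mul_le_iff₀ hP']
  exact h.trans (by gcongr)

variable {d D : ℕ} {M : Type*} [TopologicalSpace M] [ChartedSpace (EuclideanSpace ℝ (Fin d)) M]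
  [MeasurableSpace M] {ι : M → EuclideanSpace ℝ (Fin D)} {p : M → ℝ}

lemma HasBallExpansionOn.measureReal_bounds [IsProbabilityMeasure (samplingLaw (d := d) ι p)]
    {L C r₁ : ℝ} (h : HasBallExpansionOn d ι p Set.univ L C r₁) (hp : ∀ x, 0 < p x) (hC : 0 ≤ C)
    (x : M) {r : ℝ} (hr : 0 < r) (hr₁ : r < r₁) :
    (samplingLaw (d := d) ι p).real (extrinsicBall ι x r)
        ≤ volume.real (Metric.ball (0 : EuclideanSpace ℝ (Fin d)) 1) * p x
            * r ^ d * (1 + C * r ^ 2) ∧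
      volume.real (Metric.ball (0 : EuclideanSpace ℝ (Fin d)) 1) * p x
            * r ^ d * (1 - C * r ^ 2)
        ≤ (samplingLaw (d := d) ι p).real (extrinsicBall ι x r) := by
  obtain ⟨h1, h2⟩ := (h x trivial).1 r hr hr₁
  have := hp x
  exact ⟨ENNReal.toReal_le_of_le_ofReal (by positivity) h1,
    (ENNReal.ofReal_le_iff_le_toReal (measure_ne_top _ _)).1 h2⟩

/-- Expected counts in the balls of radius `(1 ± η)` times the population radius. -/
lemma HasBallExpansionOn.expected_count_bounds (hd : 1 ≤ d)
    [IsProbabilityMeasure (samplingLaw (d := d) ι p)]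
    {L C r₁ : ℝ} (h : HasBallExpansionOn d ι p Set.univ L C r₁) (hp : ∀ x, 0 < p x) (hC : 0 ≤ C)
    {N : ℕ} {k a δ b η : ℝ} (hδ : 0 ≤ δ) (hδ' : δ ≤ 1 / 11)
    (hb' : b ≤ 1 / 11) (hη : d * η = 11 / 10 * (δ + b)) (ha : 0 < a) (hk : 0 ≤ k)
    (hak : N * (volume.real (Metric.ball (0 : EuclideanSpace ℝ (Fin d)) 1) * a ^ d) = k) (x : M)
    (hr₁ : 2 * a * populationBandwidth d p x < r₁)
    (hb : C * (2 * a * populationBandwidth d p x) ^ 2 ≤ b) :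
    N * (samplingLaw (d := d) ι p).real
        (extrinsicBall ι x (a * populationBandwidth d p x * (1 - η))) ≤ k * (1 - δ) ∧
      k * (1 + δ) ≤ N * (samplingLaw (d := d) ι p).real
        (extrinsicBall ι x (a * populationBandwidth d p x * (1 + η))) := by
  have hb0 : 0 ≤ b := le_trans (by positivity) hb
  obtain ⟨hη0, hη1, hlow, hup⟩ := one_sub_pow_mul_le hd hδ hδ' hb0 hb' hη
  have hpx := hp x
  have hB0 : 0 < populationBandwidth d p x := Real.rpow_pos_of_pos hpx _
  have hBd : populationBandwidth d p x ^ d = (p x)⁻¹ := rpow_neg_one_div_pow hd hpx.le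
  set B := populationBandwidth d p x
  set m := volume.real (Metric.ball (0 : EuclideanSpace ℝ (Fin d)) 1)
  have hmass : ∀ t : ℝ, N * (m * p x * (a * B * t) ^ d) = k * t ^ d := fun t => by
    rw [mul_pow, mul_pow, hBd, ← hak]
    field_simp
  have hC' : ∀ t : ℝ, 0 ≤ t → t ≤ 2 → C * (a * B * t) ^ 2 ≤ b := fun t h0 h2 => by
    refine le_trans ?_ hb
    have : a * B * t ≤ 2 * a * B := by nlinarith [mul_pos ha hB0]
    gcongr
  constructor
  · have h1 := (h.measureReal_bounds hp hC x (r := a * B * (1 - η))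
      (mul_pos (mul_pos ha hB0) (by linarith)) (by nlinarith [mul_pos ha hB0])).1
    have h2 := hC' (1 - η) (by linarith) (by linarith)
    have h3 : 0 ≤ k * (1 - η) ^ d := mul_nonneg hk (pow_nonneg (by linarith) _)
    calc _ ≤ N * (m * p x * (a * B * (1 - η)) ^ d * (1 + C * (a * B * (1 - η)) ^ 2)) := by gcongr
      _ = k * (1 - η) ^ d * (1 + C * (a * B * (1 - η)) ^ 2) := by rw [← mul_assoc, hmass]
      _ ≤ k * (1 - η) ^ d * (1 + b) := by gcongr
      _ = k * ((1 - η) ^ d * (1 + b)) := by ring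
      _ ≤ _ := by gcongr
  · have h1 := (h.measureReal_bounds hp hC x (r := a * B * (1 + η))
      (mul_pos (mul_pos ha hB0) (by linarith)) (by nlinarith [mul_pos ha hB0])).2
    have h2 := hC' (1 + η) (by linarith) (by linarith)
    have h3 : 0 ≤ k * (1 + η) ^ d := mul_nonneg hk (pow_nonneg (by linarith) _)
    calc _ ≤ k * ((1 + η) ^ d * (1 - b)) := by gcongr
      _ = k * (1 + η) ^ d * (1 - b) := by ring
      _ ≤ k * (1 + η) ^ d * (1 - C * (a * B * (1 + η)) ^ 2) := by gcongr
      _ = N * (m * p x * (a * B * (1 + η)) ^ d * (1 - C * (a * B * (1 + η)) ^ 2)) := by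
        rw [← mul_assoc, hmass]
      _ ≤ _ := by gcongr

omit [TopologicalSpace M] [ChartedSpace (EuclideanSpace ℝ (Fin d)) M] [MeasurableSpace M] in
/-- If the counts around a nearby net point `x'` are as expected, the relative error at `x` is
small. -/
lemma relativeError_le_of_counts (hd : 1 ≤ d) (hp : ∀ x, 0 < p x) {N k : ℕ} {Y : Fin N → M}
    {x x' : M} {a η ε s : ℝ} (ha : 0 < a)
    (hak : (1 / m0 d (Set.indicator (Set.Ico 0 1) 1) * ((k : ℝ) / (N : ℝ))) ^ (-1 / (d : ℝ)) = a⁻¹)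
    (hη0 : 0 ≤ η) (hη1 : η ≤ 1) (hs : 0 ≤ s) (hε : ‖ι x - ι x'‖ ≤ ε)
    (h1 : p x ≤ p x' * (1 + s)) (h2 : p x' ≤ p x * (1 + s))
    (hlow : sampleCount (extrinsicBall ι x' (a * populationBandwidth d p x' * (1 - η))) Y < k)
    (hup : (k : ℝ) ≤ sampleCount
      (extrinsicBall ι x' (a * populationBandwidth d p x' * (1 + η))) Y) :
    |knnBandwidth d k (fun j => ι (Y j)) (ι x) - populationBandwidth d p x|
      / populationBandwidth d p x ≤ η + 2 * s + ε / (a * populationBandwidth d p x) := by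
  have hB0 : 0 < populationBandwidth d p x := Real.rpow_pos_of_pos (hp x) _
  have hB0' : 0 < populationBandwidth d p x' := Real.rpow_pos_of_pos (hp x') _
  have hBB' : populationBandwidth d p x' ≤ populationBandwidth d p x * (1 + s) :=
    rpow_neg_one_div_le_mul hd (hp x) (hp x') hs h1
  have hB'B : populationBandwidth d p x ≤ populationBandwidth d p x' * (1 + s) :=
    rpow_neg_one_div_le_mul hd (hp x') (hp x) hs h2
  set B := populationBandwidth d p x
  set B' := populationBandwidth d p x'
  have hε0 : 0 ≤ ε := (norm_nonneg _).trans hε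
  -- Balls at `x` and `x'` are nested after a change of radius by `ε`, so the counts at `x'` trap
  -- `R̂(x)` between `a B' (1 - η) - ε` and `a B' (1 + η) + ε`. Trading `B'` for `B` costs a factor
  -- within `1 ± s`, and `η ≤ 1` gives the term `2 s`.
  have hup' : (k : ℝ) ≤ sampleCount (extrinsicBall ι x (a * B' * (1 + η) + ε)) Y :=
    hup.trans (sampleCount_mono (extrinsicBall_subset (by rwa [norm_sub_rev])) Y)
  have hlow' : sampleCount (extrinsicBall ι x (a * B' * (1 - η) - ε)) Y < k := by
    refine (sampleCount_mono (extrinsicBall_subset hε) Y).trans_lt ?_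
    rwa [sub_add_cancel]
  have hr : 0 < a * B' * (1 + η) + ε := by positivity
  have hR1 := knnRadius_le hr hup'
  have hR2 := le_knnRadius hr hup' hlow'
  set R := knnRadius k (fun j => ι (Y j)) (ι x)
  have heq : |knnBandwidth d k (fun j => ι (Y j)) (ι x) - B| / B = |R / (a * B) - 1| := by
    rw [knnBandwidth, hak, ← abs_of_pos hB0, ← abs_div, abs_of_pos hB0]
    congr 1
    change (R * a⁻¹ - B) / B = R / (a * B) - 1
    field_simp
  have haB : 0 < a * B := mul_pos ha hB0
  rw [heq, abs_le]
  have hlowB : a * B * (1 - s) ≤ a * B' := by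
    have h3 : B * (1 - s) ≤ B' := by
      by_cases hs1 : s ≤ 1
      · calc B * (1 - s) ≤ B' * (1 + s) * (1 - s) := by gcongr
          _ = B' - B' * s ^ 2 := by ring
          _ ≤ B' := by nlinarith [mul_nonneg hB0'.le (sq_nonneg s)]
      · nlinarith
    nlinarith
  constructor
  · rw [neg_le_sub_iff_le_add, ← sub_le_iff_le_add, le_div_iff₀ haB]
    have h4 : ε / (a * B) * (a * B) = ε := div_mul_cancel₀ _ haB.ne'
    have h5 : a * B * (1 - s) * (1 - η) ≤ a * B' * (1 - η) :=
      mul_le_mul_of_nonneg_right hlowB (by linarith)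
    nlinarith [mul_nonneg haB.le hs, mul_nonneg haB.le (mul_nonneg hs hη0)]
  · rw [sub_le_iff_le_add, div_le_iff₀ haB]
    have h4 : ε / (a * B) * (a * B) = ε := div_mul_cancel₀ _ haB.ne'
    have h5 : a * B' * (1 + η) ≤ a * (B * (1 + s)) * (1 + η) := by gcongr
    nlinarith [mul_nonneg haB.le (mul_nonneg hs (sub_nonneg.2 hη1))]

end RelativeError

/-! ### Union bound over the net -/

section Concentration

variable {d D : ℕ} {M : Type*} [TopologicalSpace M] [ChartedSpace (EuclideanSpace ℝ (Fin d)) M]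
  [MeasurableSpace M] {ι : M → EuclideanSpace ℝ (Fin D)} {p : M → ℝ}

lemma isProbabilityMeasure_samplingLaw (hp : ∀ x, 0 ≤ p x)
    (hmass : ∫ x, p x ∂(riemannianVolume (d := d) ι) = 1) :
    IsProbabilityMeasure (samplingLaw (d := d) ι p) := by
  have hint : Integrable p (riemannianVolume (d := d) ι) := by
    -- A nonintegrable function has Bochner integral `0`, so total mass `1` already forces
    -- integrability.
    by_contra h
    rw [integral_undef h] at hmass
    exact zero_ne_one hmass
  constructor
  rw [samplingLaw, withDensity_apply _ MeasurableSet.univ, Measure.restrict_univ,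
    ← ofReal_integral_eq_lintegral_ofReal hint (ae_of_all _ hp), hmass, ENNReal.ofReal_one]

lemma one_sub_le_measureReal_supRelativeError_le [BorelSpace M] (hd : 1 ≤ d) (hι : Continuous ι)
    [IsProbabilityMeasure (samplingLaw (d := d) ι p)]
    {L C r₁ : ℝ} (h : HasBallExpansionOn d ι p Set.univ L C r₁) (hp : ∀ x, 0 < p x) (hC : 0 ≤ C)
    {N k : ℕ} {a δ b η ε s W : ℝ} (hδ : 0 ≤ δ) (hδ' : δ ≤ 1 / 11)
    (hb' : b ≤ 1 / 11) (hη : d * η = 11 / 10 * (δ + b)) (ha : 0 < a)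
    (hak : N * (volume.real (Metric.ball (0 : EuclideanSpace ℝ (Fin d)) 1) * a ^ d) = k)
    (hak' : (1 / m0 d (Set.indicator (Set.Ico 0 1) 1) * ((k : ℝ) / (N : ℝ))) ^ (-1 / (d : ℝ)) = a⁻¹)
    (hr₁ : ∀ x, 2 * a * populationBandwidth d p x < r₁)
    (hb : ∀ x, C * (2 * a * populationBandwidth d p x) ^ 2 ≤ b)
    (hs : 0 ≤ s) (hclose : ∀ x x', ‖ι x - ι x'‖ < ε → p x ≤ p x' * (1 + s))
    (hW : ∀ x, η + 2 * s + ε / (a * populationBandwidth d p x) ≤ W)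
    (T : Finset M) (hT : ∀ x, ∃ x' ∈ T, ‖ι x - ι x'‖ < ε) :
    1 - T.card * (2 * Real.exp (-(k * δ ^ 2 / 4 * (1 - δ)))) ≤
      (Measure.pi (fun _ : Fin N => samplingLaw (d := d) ι p)).real
        {Y | supRelativeError d ι p k Y ≤ ENNReal.ofReal W} := by
  rcases isEmpty_or_nonempty M with hM | ⟨⟨x₀⟩⟩
  · have h1 : (samplingLaw (d := d) ι p) Set.univ = 1 := measure_univ
    rw [Set.univ_eq_empty_iff.2 hM, measure_empty] at h1
    exact absurd h1 zero_ne_one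
  have hb0 : 0 ≤ b := le_trans (by positivity) (hb x₀)
  obtain ⟨hη0, hη1, -, -⟩ := one_sub_pow_mul_le hd hδ hδ' hb0 hb' hη
  set ν := samplingLaw (d := d) ι p with hν
  set P := Measure.pi (fun _ : Fin N => ν) with hP
  set lo : M → Set (Fin N → M) := fun x => {Y | (k : ℝ) ≤ sampleCount
    (extrinsicBall ι x (a * populationBandwidth d p x * (1 - η))) Y} with hlo
  set hi : M → Set (Fin N → M) := fun x => {Y | sampleCount
    (extrinsicBall ι x (a * populationBandwidth d p x * (1 + η))) Y ≤ (k : ℝ)} with hhi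
  set e := Real.exp (-(k * δ ^ 2 / 4 * (1 - δ))) with he
  have hbad : ∀ x, P.real (lo x ∪ hi x) ≤ 2 * e := fun x => by
    obtain ⟨h1, h2⟩ := h.expected_count_bounds hd hp hC hδ hδ' hb' hη ha (Nat.cast_nonneg k) hak x
      (hr₁ x) (hb x)
    have h3 := measureReal_le_sampleCount_le ν N (measurableSet_extrinsicBall hι x _)
      (Nat.cast_nonneg k) hδ (by linarith) h1
    have h4 := measureReal_sampleCount_le_le ν N (measurableSet_extrinsicBall hι x _)
      hδ (by linarith) h2
    have h5 : Real.exp (-(k * δ ^ 2 / 4)) ≤ e := by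
      refine Real.exp_le_exp.2 (neg_le_neg ?_)
      exact mul_le_of_le_one_right (by positivity) (by linarith)
    calc P.real (lo x ∪ hi x) ≤ P.real (lo x) + P.real (hi x) := measureReal_union_le _ _
      _ ≤ e + e := add_le_add (h3.trans h5) h4
      _ = 2 * e := by ring
  set bad : Set (Fin N → M) := ⋃ x ∈ T, lo x ∪ hi x with hbaddef
  have hbadT : P.real bad ≤ T.card * (2 * e) := by
    calc P.real bad ≤ ∑ x ∈ T, P.real (lo x ∪ hi x) := measureReal_biUnion_finset_le _ _
      _ ≤ ∑ _x ∈ T, 2 * e := Finset.sum_le_sum fun x _ => hbad x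
      _ = T.card * (2 * e) := by rw [Finset.sum_const, nsmul_eq_mul]
  set good := {Y : Fin N → M | supRelativeError d ι p k Y ≤ ENNReal.ofReal W} with hgood
  have hcover : (Set.univ : Set (Fin N → M)) ⊆ good ∪ bad := fun Y _ => by
    by_cases hY : Y ∈ bad
    · exact Or.inr hY
    refine Or.inl (iSup_le fun x => ENNReal.ofReal_le_ofReal ?_)
    obtain ⟨x', hx', hxx'⟩ := hT x
    have hY' : Y ∉ lo x' ∪ hi x' := fun hmem => hY (Set.mem_biUnion hx' hmem)
    rw [Set.mem_union, not_or] at hY'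
    exact (relativeError_le_of_counts hd hp ha hak' hη0 (by linarith) hs hxx'.le
      (hclose x x' hxx') (hclose x' x (by rwa [norm_sub_rev]))
      (not_le.1 hY'.1) (not_le.1 hY'.2).le).trans (hW x)
  -- Subadditivity is used instead of complements, so measurability of `good`, defined by an
  -- uncountable supremum, is not needed.
  have h1 : (1 : ℝ) ≤ P.real good + P.real bad := by
    calc (1 : ℝ) = P.real Set.univ := probReal_univ.symm
      _ ≤ P.real (good ∪ bad) := measureReal_mono hcover
      _ ≤ _ := measureReal_union_le _ _
  linarith

end Concentration

end

/-! ### Numerical constants and rates -/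

section Rates

/-- The exponent is at least `81 / 4 * 10 / 11 > 15` times `log N`. The power `15` leaves room for a
net of `N⁴` points and for the factor `2` in the target `N⁻¹⁰`. -/
lemma exp_neg_tail_le {N : ℕ} (hN : 1 ≤ N) {k δ : ℝ} (hδ' : δ ≤ 1 / 11)
    (h : k * δ ^ 2 = 81 * Real.log N) :
    Real.exp (-(k * δ ^ 2 / 4 * (1 - δ))) ≤ ((N : ℝ) ^ 15)⁻¹ := by
  have hN0 : (0 : ℝ) < N := by exact_mod_cast hN
  have hlog : 0 ≤ Real.log N := Real.log_natCast_nonneg N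
  rw [Real.exp_neg]
  refine inv_anti₀ (by positivity) ?_
  calc (N : ℝ) ^ 15 = Real.exp (15 * Real.log N) := by
        rw [mul_comm, Real.exp_mul, Real.exp_log hN0]
        norm_cast
    _ ≤ _ := by
        rw [h]
        refine Real.exp_le_exp.2 ?_
        nlinarith

lemma nine_mul_eleven_tenths_le_three_mul_sqrt : 99 / 10 ≤ 3 * Real.sqrt 13 := by
  have : (33 / 10 : ℝ) ≤ Real.sqrt 13 := Real.le_sqrt_of_sq_le (by norm_num)
  linarith

lemma tendsto_rate {d : ℕ} (hd : 1 ≤ d) {k : ℕ → ℕ}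
    (h1 : Tendsto (fun N : ℕ => (k N : ℝ) / N) atTop (𝓝 0))
    (h2 : Tendsto (fun N : ℕ => Real.log N / k N) atTop (𝓝 0)) (C c : ℝ) :
    Tendsto (fun N : ℕ => C * ((k N : ℝ) / N) ^ (2 / (d : ℝ))
      + c * Real.sqrt (Real.log N / k N)) atTop (𝓝 0) := by
  have hd' : (0 : ℝ) < 2 / (d : ℝ) := by positivity
  have h3 := (h1.rpow_const (p := 2 / (d : ℝ)) (Or.inr hd'.le)).const_mul C
  have h4 := h2.sqrt.const_mul c
  rw [Real.zero_rpow hd'.ne', mul_zero] at h3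
  rw [Real.sqrt_zero, mul_zero] at h4
  simpa using h3.add h4

lemma card_net_mul_tail_lt {N t : ℕ} {c Γ e : ℝ} (hΓ : 0 < Γ) (hN : Γ + 2 < N)
    (hc : (Γ * (N : ℝ) ^ 3)⁻¹ ≤ c) (ht : c * t ≤ 1) (he : e ≤ ((N : ℝ) ^ 15)⁻¹) :
    t * (2 * e) < (N : ℝ) ^ (-10 : ℤ) := by
  have hN2 : (2 : ℝ) < N := by linarith
  have hN0 : (0 : ℝ) < N := by linarith
  have h1 : (t : ℝ) ≤ (N : ℝ) ^ 4 := by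
    have h2 : (Γ * (N : ℝ) ^ 3)⁻¹ * t ≤ 1 :=
      (mul_le_mul_of_nonneg_right hc (Nat.cast_nonneg t)).trans ht
    rw [inv_mul_le_iff₀ (by positivity), mul_one] at h2
    refine h2.trans ?_
    calc Γ * (N : ℝ) ^ 3 ≤ N * (N : ℝ) ^ 3 := by gcongr; linarith
      _ = (N : ℝ) ^ 4 := by ring
  calc t * (2 * e) ≤ t * (2 * ((N : ℝ) ^ 15)⁻¹) := by gcongr
    _ ≤ (N : ℝ) ^ 4 * (2 * ((N : ℝ) ^ 15)⁻¹) := by gcongr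
    _ = 2 * ((N : ℝ) ^ 11)⁻¹ := by field_simp
    _ < N * ((N : ℝ) ^ 11)⁻¹ := by gcongr
    _ = (N : ℝ) ^ (-10 : ℤ) := by
      rw [zpow_neg]
      field_simp

end Rates

/-! ### Choice of parameters and conclusion -/

theorem theorem2p1 {d D : ℕ} (hd : 1 ≤ d)
    {M : Type*} [TopologicalSpace M] [ChartedSpace (EuclideanSpace ℝ (Fin d)) M]
    [IsManifold (𝓡 d) ∞ M] [CompactSpace M] [MeasurableSpace M] [BorelSpace M]
    (ι : M → EuclideanSpace ℝ (Fin D))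
    (hι : Manifold.IsSmoothEmbedding (𝓡 d) (𝓡 D) ∞ ι)
    (p : M → ℝ) (hp : ContMDiff (𝓡 d) 𝓘(ℝ, ℝ) ∞ p)
    (hbound : ∃ pmin pmax : ℝ, 0 < pmin ∧ ∀ x, pmin ≤ p x ∧ p x ≤ pmax)
    (hmass : ∫ x, p x ∂(riemannianVolume (d := d) ι) = 1) :
    ∃ C : ℝ, 0 < C ∧ ∀ k : ℕ → ℕ,
      (fun N : ℕ => (k N : ℝ)) =o[atTop] (fun N : ℕ => (N : ℝ)) →
      Tendsto (fun N : ℕ => (k N : ℝ) / Real.log N) atTop atTop →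
        (∀ᶠ N : ℕ in atTop,
          (Measure.pi (fun _ : Fin N => samplingLaw (d := d) ι p)).real
              {Y : Fin N → M | supRelativeError d ι p (k N) Y ≤
                ENNReal.ofReal (C * ((k N : ℝ) / N) ^ (2 / (d : ℝ))
                  + 3 * Real.sqrt 13 / d * Real.sqrt (Real.log N / k N))}
            > 1 - (N : ℝ) ^ (-10 : ℤ)) ∧
        Tendsto (fun N : ℕ => C * ((k N : ℝ) / N) ^ (2 / (d : ℝ))
            + 3 * Real.sqrt 13 / d * Real.sqrt (Real.log N / k N)) atTop (𝓝 0) := by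
  obtain ⟨pmin, pmax, hpmin, hpb⟩ := hbound
  have hpos : ∀ x, 0 < p x := fun x => hpmin.trans_le (hpb x).1
  have hprob := isProbabilityMeasure_samplingLaw (fun x => (hpos x).le) hmass
  have hιc : Continuous ι := hι.isEmbedding.continuous
  obtain ⟨x₀⟩ : Nonempty M := by
    by_contra hM
    rw [not_nonempty_iff] at hM
    have h1 : (samplingLaw (d := d) ι p) Set.univ = 1 := measure_univ
    rw [Set.univ_eq_empty_iff.2 hM, measure_empty] at h1
    exact zero_ne_one h1
  have hpmax : 0 < pmax := (hpos x₀).trans_le (hpb x₀).2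
  obtain ⟨L, C₀, r₁, hL, hC₀, hr₁, hexp⟩ := exists_hasBallExpansionOn_univ hι hp hpos
  have hd' : (1 : ℝ) ≤ d := by exact_mod_cast hd
  have hd0 : (0 : ℝ) < d := by linarith
  set m := volume.real (Metric.ball (0 : EuclideanSpace ℝ (Fin d)) 1) with hm
  have hm0 : 0 < m :=
    ENNReal.toReal_pos (Metric.measure_ball_pos _ _ one_pos).ne' measure_ball_lt_top.ne
  set Bmin := pmax ^ (-1 / (d : ℝ)) with hBmin
  set Bmax := pmin ^ (-1 / (d : ℝ)) with hBmax
  have hBmin0 : 0 < Bmin := Real.rpow_pos_of_pos hpmax _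
  have hBmax0 : 0 < Bmax := Real.rpow_pos_of_pos hpmin _
  have hexpo : -1 / (d : ℝ) ≤ 0 := div_nonpos_of_nonpos_of_nonneg (by norm_num) hd0.le
  have hB1 : ∀ x, Bmin ≤ populationBandwidth d p x := fun x =>
    Real.rpow_le_rpow_of_nonpos (hpos x) (hpb x).2 hexpo
  have hB2 : ∀ x, populationBandwidth d p x ≤ Bmax := fun x =>
    Real.rpow_le_rpow_of_nonpos hpmin (hpb x).1 hexpo
  -- The coefficients of `a²` from the three deterministic errors: curvature bias `b`, variation of
  -- `p` within `ε`, and displacement `ε` relative to the population radius.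
  set C₁ := 11 / 10 * (C₀ * (2 * Bmax) ^ 2) + 2 * (L / pmin) + 1 / Bmin with hC₁
  have hC₁0 : 0 < C₁ := by positivity
  refine ⟨C₁ * (1 / m) ^ (2 / (d : ℝ)), by positivity, fun k hk1 hk2 => ?_⟩
  have hlim1 : Tendsto (fun N : ℕ => (k N : ℝ) / N) atTop (𝓝 0) := hk1.tendsto_div_nhds_zero
  have hlim2 : Tendsto (fun N : ℕ => Real.log N / k N) atTop (𝓝 0) := by
    have := tendsto_inv_atTop_zero.comp hk2
    refine this.congr fun N => ?_
    simp
  refine ⟨?_, tendsto_rate hd hlim1 hlim2 _ _⟩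
  have hlima : Tendsto (fun N : ℕ => (1 / m * ((k N : ℝ) / N)) ^ (1 / (d : ℝ))) atTop (𝓝 0) := by
    have h1 := (hlim1.const_mul (1 / m)).rpow_const (p := 1 / (d : ℝ)) (Or.inr (by positivity))
    rwa [mul_zero, Real.zero_rpow (by positivity)] at h1
  have hlimδ : Tendsto (fun N : ℕ => 9 * Real.sqrt (Real.log N / k N)) atTop (𝓝 0) := by
    have h1 := hlim2.sqrt.const_mul 9
    rwa [Real.sqrt_zero, mul_zero] at h1
  have hsmall : ∀ᶠ a : ℝ in 𝓝 0, a < 1 ∧ 2 * a * Bmax < r₁ ∧ C₀ * (2 * a * Bmax) ^ 2 < 1 / 11 ∧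
      a ^ 3 < r₁ ∧ C₀ * (a ^ 3 / 2) ^ 2 < 1 / 2 := by
    have e1 : Tendsto (fun a : ℝ => 2 * a * Bmax) (𝓝 0) (𝓝 0) :=
      Continuous.tendsto' (by fun_prop) _ _ (by simp)
    have e2 : Tendsto (fun a : ℝ => C₀ * (2 * a * Bmax) ^ 2) (𝓝 0) (𝓝 0) :=
      Continuous.tendsto' (by fun_prop) _ _ (by simp)
    have e3 : Tendsto (fun a : ℝ => a ^ 3) (𝓝 0) (𝓝 0) :=
      Continuous.tendsto' (by fun_prop) _ _ (by simp)
    have e4 : Tendsto (fun a : ℝ => C₀ * (a ^ 3 / 2) ^ 2) (𝓝 0) (𝓝 0) :=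
      Continuous.tendsto' (by fun_prop) _ _ (by simp)
    filter_upwards [eventually_lt_nhds one_pos, e1.eventually (eventually_lt_nhds hr₁),
      e2.eventually (eventually_lt_nhds (by norm_num : (0 : ℝ) < 1 / 11)),
      e3.eventually (eventually_lt_nhds hr₁),
      e4.eventually (eventually_lt_nhds (by norm_num : (0 : ℝ) < 1 / 2))] with a q1 q2 q3 q4 q5
    exact ⟨q1, q2, q3, q4, q5⟩
  -- A ball of radius `a³ / 2` has mass at least `m pmin (1 / (m N))³ 2⁻ᵈ / 2`, using `k ≥ 1` and
  -- halving for the curvature correction; this equals `1 / (Γ N³)`.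
  set Γ := m ^ 2 * 2 ^ (d + 1) / pmin with hΓ
  have hΓ0 : 0 < Γ := by positivity
  have hlog : ∀ᶠ N : ℕ in atTop, 0 < Real.log N :=
    (Real.tendsto_log_atTop.comp tendsto_natCast_atTop_atTop).eventually_gt_atTop 0
  filter_upwards [hlima.eventually hsmall, hlimδ.eventually (eventually_le_nhds
      (by norm_num : (0 : ℝ) < 1 / 11)), hk2.eventually_gt_atTop 0, hlog,
      tendsto_natCast_atTop_atTop.eventually_gt_atTop (Γ + 2)] with N hsm hδ' hkN hlogN hNΓ
  obtain ⟨ha1, har, hab, hεr, hεC⟩ := hsm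
  have hN0 : (0 : ℝ) < N := by linarith
  have hk0 : (0 : ℝ) < k N := by
    rcases (Nat.cast_nonneg (α := ℝ) (k N)).eq_or_lt with h0 | h0
    · rw [← h0, zero_div] at hkN
      exact absurd hkN (lt_irrefl _)
    · exact h0
  have hk1' : (1 : ℝ) ≤ k N := by exact_mod_cast hk0
  set a := (1 / m * ((k N : ℝ) / N)) ^ (1 / (d : ℝ)) with hadef
  set σ := Real.sqrt (Real.log N / k N) with hσ
  have hσ0 : 0 ≤ σ := Real.sqrt_nonneg _
  have hbase : 0 < 1 / m * ((k N : ℝ) / N) := by positivity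
  have ha0 : 0 < a := Real.rpow_pos_of_pos hbase _
  have had : a ^ d = 1 / m * ((k N : ℝ) / N) := by
    rw [hadef, ← Real.rpow_natCast, ← Real.rpow_mul hbase.le, one_div_mul_cancel hd0.ne',
      Real.rpow_one]
  have ha2 : a ^ 2 = (1 / m) ^ (2 / (d : ℝ)) * ((k N : ℝ) / N) ^ (2 / (d : ℝ)) := by
    rw [hadef, ← Real.rpow_natCast, ← Real.rpow_mul hbase.le,
      ← Real.mul_rpow (by positivity) (by positivity)]
    congr 1
    push_cast
    ring
  set b := C₀ * (2 * a * Bmax) ^ 2 with hb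
  set η := 11 / 10 * (9 * σ + b) / d with hη
  -- The mesh must be `O(a³)` for `ε / (a ρ̄)` to be `O(a²)`, and a power of `a` keeps the net
  -- polynomial in `N`, since `a^(3d)` is of order `(k / N)³`.
  set ε := a ^ 3 with hε
  have hε0 : 0 < ε := by positivity
  set s := L * ε / pmin with hs
  have hkδ : (k N : ℝ) * (9 * σ) ^ 2 = 81 * Real.log N := by
    rw [mul_pow, hσ, Real.sq_sqrt (by positivity)]
    field_simp
    norm_num
  have hball : ∀ x, (Γ * (N : ℝ) ^ 3)⁻¹
      ≤ (samplingLaw (d := d) ι p).real (extrinsicBall ι x (ε / 2)) := fun x => by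
    refine le_trans ?_ (hexp.measureReal_bounds hpos hC₀ x (by positivity : 0 < ε / 2)
      (by linarith)).2
    have h1 : (ε / 2) ^ d = (1 / m * ((k N : ℝ) / N)) ^ 3 / 2 ^ d := by
      rw [div_pow, hε, ← had]
      ring
    rw [h1]
    have h2 : (1 / m * (1 / (N : ℝ))) ^ 3 ≤ (1 / m * ((k N : ℝ) / N)) ^ 3 := by gcongr
    calc (Γ * (N : ℝ) ^ 3)⁻¹ = m * pmin * ((1 / m * (1 / (N : ℝ))) ^ 3 / 2 ^ d) * (1 / 2) := by
          rw [hΓ]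
          field_simp
          ring
      _ ≤ m * p x * ((1 / m * ((k N : ℝ) / N)) ^ 3 / 2 ^ d) * (1 - C₀ * (ε / 2) ^ 2) := by
          have h3 := (hpb x).1
          have h4 := hpos x
          gcongr
          linarith
  obtain ⟨T, hTcard, hT⟩ := exists_finset_net (ε := ε) hιc (samplingLaw (d := d) ι p)
    (by positivity) hball
  have hW : ∀ x, η + 2 * s + ε / (a * populationBandwidth d p x)
      ≤ C₁ * (1 / m) ^ (2 / (d : ℝ)) * ((k N : ℝ) / N) ^ (2 / (d : ℝ))
        + 3 * Real.sqrt 13 / d * σ := fun x => by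
    have h1 : η ≤ 11 / 10 * (C₀ * (2 * Bmax) ^ 2) * a ^ 2 + 3 * Real.sqrt 13 / d * σ := by
      have e1 : η = 11 / 10 * (C₀ * (2 * Bmax) ^ 2) * a ^ 2 / d + 99 / 10 * σ / d := by
        rw [hη, hb]; ring
      rw [e1]
      -- The factor `1 / d` is dropped from the bias, where constants are free, but kept in the
      -- stochastic term, where `11 / 10 * 9 ≤ 3 √13`.
      refine add_le_add (div_le_self (by positivity) hd') ?_
      calc 99 / 10 * σ / d ≤ 3 * Real.sqrt 13 * σ / d := by
            gcongr
            exact nine_mul_eleven_tenths_le_three_mul_sqrt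
        _ = _ := by ring
    have h2 : s ≤ L / pmin * a ^ 2 := by
      have e1 : s = L / pmin * a ^ 3 := by rw [hs, hε]; ring
      rw [e1]
      have : a ^ 3 ≤ a ^ 2 := pow_le_pow_of_le_one ha0.le ha1.le (by norm_num)
      gcongr
    have h3 : ε / (a * populationBandwidth d p x) ≤ 1 / Bmin * a ^ 2 := by
      calc ε / (a * populationBandwidth d p x) ≤ ε / (a * Bmin) := by
            gcongr
            exact hB1 x
        _ = 1 / Bmin * a ^ 2 := by rw [hε]; field_simp
    calc _ ≤ C₁ * a ^ 2 + 3 * Real.sqrt 13 / d * σ := by rw [hC₁]; linarith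
      _ = _ := by rw [ha2]; ring
  have hclose : ∀ x x', ‖ι x - ι x'‖ < ε → p x ≤ p x' * (1 + s) := fun x x' hxx' => by
    have h1 := (hexp x' trivial).2 x (hxx'.trans hεr)
    have h2 : L * ‖ι x - ι x'‖ ≤ L * ε := by gcongr
    have h3 : L * ε ≤ p x' * s := by
      calc L * ε = pmin * s := by rw [hs]; field_simp
        _ ≤ p x' * s := by
          gcongr
          exact (hpb x').1
    linarith [(abs_le.1 h1).2]
  have hmain := one_sub_le_measureReal_supRelativeError_le hd hιc hexp hpos hC₀ (N := N) (k := k N)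
    (a := a) (δ := 9 * σ) (b := b) (η := η) (ε := ε) (s := s) (by positivity) hδ' hab.le
    (by rw [hη]; field_simp) ha0 (by rw [← hm, had]; field_simp)
    (by rw [m0_indicator_Ico, hadef, neg_div, Real.rpow_neg hbase.le])
    (fun x => lt_of_le_of_lt (by gcongr; exact hB2 x) har)
    (fun x => by
      have h0 : 0 ≤ populationBandwidth d p x := hBmin0.le.trans (hB1 x)
      rw [hb]
      gcongr
      exact hB2 x)
    (by positivity) hclose hW T hT
  have htail := card_net_mul_tail_lt hΓ0 hNΓ le_rfl hTcard
    (exp_neg_tail_le (by exact_mod_cast hN0) hδ' hkδ)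
  refine lt_of_lt_of_le ?_ hmain
  linarith
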